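/- For integers $d\ge 1$, $\ell\ge 0$ let $\mathrm{Harm}_\ell(\mathbb{R}^d)$ be the space of real polynomials in $d$ variables that are homogeneous of degree $\ell$ and annihilated by $\sum_{j=1}^d \partial^2/\partial x_j^2$. For a set $T$ of non-negative integers, a non-empty finite subset $X$ of the unit sphere $\mathbb{S}^{d-1}\subset\mathbb{R}^d$ is called a spherical $T$-design if $\sum_{x\in X}P(x)=0$ for all $P\in\mathrm{Harm}_\ell(\mathbb{R}^d)$ and all $\ell\in T$. The harmonic strength of $X$ is the largest set $T$ such that $X$ is a spherical $T$-design. Let $D_4\subset\mathbb{R}^4$ be the lattice generated over $\mathbb{Z}$ by all permutations of $(\pm1,\pm1,0,0)$, and for $m\ge1$ let $(D_4)_{2m}=\{x\in D_4 : \langle x,x\rangle=2m\}$ be its $2m$-shell. Let $\eta(z)=q^{1/24}\prod_{n\ge1}(1-q^n)$, where $q=e^{2\pi i z}$ and $\operatorname{Im} z>0$ (so $q^{1/24}=e^{2\pi i z/24}$), be the Dedekind eta function. **Theorem.** The function $\eta(z)^8\eta(2z)^8$ is the unique normalized cusp form of weight $8$ on $\Gamma_1(2)$, where normalized means that the coefficient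 of $q$ in its $q$-expansion is $1$. Write $\eta(z)^8\eta(2z)^8=\sum_{m\ge1}\tau_2(m)q^m$ for its $q$-expansion. Then, for every integer $m\ge1$, the harmonic strength of $\frac{1}{\sqrt{2m}}(D_4)_{2m}$ contains $6$ (that is, $\frac{1}{\sqrt{2m}}(D_4)_{2m}$ is a spherical $\{6\}$-design) if and only if $\tau_2(m)=0$. -/

import Mathlib

noncomputable section

namespace LatticeDesign

open MvPolynomial

/-- The Laplacian `∑ⱼ ∂²/∂xⱼ²` on the polynomial ring `ℝ[x₁, …, x_d]`. -/
def laplacian (d : ℕ) : MvPolynomial (Fin d) ℝ →ₗ[ℝ] MvPolynomial (Fin d) ℝ :=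
  ∑ j : Fin d, (pderiv j).toLinearMap ∘ₗ (pderiv j).toLinearMap

/-- `Harm_ℓ(ℝ^d)`: the real polynomials in `d` variables that are homogeneous of degree `ℓ` and
annihilated by the Laplacian. -/
def Harm (d ℓ : ℕ) : Submodule ℝ (MvPolynomial (Fin d) ℝ) :=
  homogeneousSubmodule (Fin d) ℝ ℓ ⊓ LinearMap.ker (laplacian d)

/-- `X` is a spherical design of harmonic index `T` (a spherical `T`-design): a non-empty finite
subset of the unit sphere of `ℝ^d` such that `∑_{x ∈ X} P(x) = 0` for all `P ∈ Harm_ℓ(ℝ^d)` and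
all `ℓ ∈ T`. -/
structure IsSphericalDesign {d : ℕ} (T : Set ℕ) (X : Set (EuclideanSpace ℝ (Fin d))) : Prop where
  nonempty : X.Nonempty
  finite : X.Finite
  subset_sphere : X ⊆ Metric.sphere 0 1
  sum_eq_zero : ∀ ℓ ∈ T, ∀ P ∈ Harm d ℓ, ∑ᶠ x ∈ X, eval (fun i ↦ x i) P = 0

/-- The harmonic strength of `X`: the largest `T` such that `X` is a spherical `T`-design, formed
as the union of all such `T`; see `isGreatest_harmonicStrength`. -/
def harmonicStrength {d : ℕ} (X : Set (EuclideanSpace ℝ (Fin d))) : Set ℕ :=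
  ⋃₀ {T | IsSphericalDesign T X}

theorem isGreatest_harmonicStrength {d : ℕ} {X : Set (EuclideanSpace ℝ (Fin d))}
    (h₁ : X.Nonempty) (h₂ : X.Finite) (h₃ : X ⊆ Metric.sphere 0 1) :
    IsGreatest {T | IsSphericalDesign T X} (harmonicStrength X) := by
  refine ⟨⟨h₁, h₂, h₃, ?_⟩, fun T hT ↦ Set.subset_sUnion_of_mem hT⟩
  rintro ℓ ⟨T, hT, hℓ⟩ P hP
  exact hT.sum_eq_zero ℓ hℓ P hP

theorem mem_harmonicStrength_iff {d : ℕ} {X : Set (EuclideanSpace ℝ (Fin d))} {ℓ : ℕ} :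
    ℓ ∈ harmonicStrength X ↔ IsSphericalDesign {ℓ} X := by
  refine ⟨?_, fun h ↦ ⟨{ℓ}, h, rfl⟩⟩
  rintro ⟨T, hT, hℓ⟩
  refine ⟨hT.nonempty, hT.finite, hT.subset_sphere, ?_⟩
  rintro k rfl P hP
  exact hT.sum_eq_zero _ hℓ P hP

/-- The `D₄` lattice: the additive subgroup of `ℝ⁴` generated by all permutations of
`(±1, ±1, 0, 0)`. -/
def D4 : AddSubgroup (EuclideanSpace ℝ (Fin 4)) :=
  AddSubgroup.closure
    {x | ∃ i j : Fin 4, i ≠ j ∧ ∃ a b : ℝ, (a = 1 ∨ a = -1) ∧ (b = 1 ∨ b = -1) ∧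
      x = EuclideanSpace.single i a + EuclideanSpace.single j b}

/-- The `n`-shell of a lattice: its points `x` with `⟨x, x⟩ = n`. -/
def shell {d : ℕ} (L : AddSubgroup (EuclideanSpace ℝ (Fin d))) (n : ℕ) :
    Set (EuclideanSpace ℝ (Fin d)) :=
  {x | x ∈ L ∧ inner ℝ x x = (n : ℝ)}

/-- The normalized `n`-shell `(1/√n) · L_n`. -/
def normalizedShell {d : ℕ} (L : AddSubgroup (EuclideanSpace ℝ (Fin d))) (n : ℕ) :
    Set (EuclideanSpace ℝ (Fin d)) :=
  (fun x ↦ (1 / Real.sqrt n) • x) '' shell L n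

/-- The function `η(z)⁸ η(2z)⁸` on the upper half-plane. -/
def etaProduct (z : UpperHalfPlane) : ℂ :=
  ModularForm.eta (z : ℂ) ^ 8 * ModularForm.eta (2 * (z : ℂ)) ^ 8

/-- `τ₂(m)`: the `m`-th coefficient of the expansion of `η(z)⁸ η(2z)⁸` in `q = exp(2πiz)`. -/
def tau2 (m : ℕ) : ℂ :=
  (UpperHalfPlane.qExpansion 1 etaProduct).coeff m

/-- The complex vector space of cusp forms of weight `k` on `Γ₁(N)`. -/
abbrev CuspFormGamma1 (N : ℕ) (k : ℤ) : Type :=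
  CuspForm ((CongruenceSubgroup.Gamma1 N).map (Matrix.SpecialLinearGroup.mapGL ℝ)) k

/-- A cusp form on `Γ₁(N)` is normalized if the coefficient of `q` in its expansion in
`q = exp(2πiz)` is `1`. -/
def IsNormalized {N : ℕ} {k : ℤ} (f : CuspFormGamma1 N k) : Prop :=
  (UpperHalfPlane.qExpansion 1 f).coeff 1 = 1

end LatticeDesign

end

/-! ### Invariance under Γ₁(2), checked on the generators of SL₂(ℤ) -/

section

open ModularForm UpperHalfPlane CongruenceSubgroup ModularGroup MatrixGroups

namespace LatticeDesign

/-! The `2m`-shell of D₄ consists of all integral points of norm `2m`, since an integer and its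
square have the same parity. It is stable under permutations and sign changes of the coordinates.
Averaging over this group leaves a one-dimensional space of harmonic sextics. So every harmonic sum
of degree 6 over the shell is a multiple of one number, the sum of `sexticForm`
(`sum_eval_of_mem_Harm`), and the multiplier is nonzero for the explicit `sexticHarmonic`. The
design condition is therefore the vanishing of that number.

The generating series of these numbers is modular. The sum over ℤ⁴ of `sexticForm x` times
exp(πi|x|²z) is, up to a constant, the polynomial `bracket` in Jacobi's θ and its derivatives, whose
coefficients 1, -15, 30 make the non-modular terms cancel (`bracket_neg_one_div`). Adding the
translate by 1 keeps the even norms only, and the result `thetaD4` is a cusp form of weight 8 on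
Γ₁(2).

The space of such forms is a line. The product η(z)⁸η(2z)⁸ has no zero on ℍ and vanishes to the
least order a cusp form can have at each cusp: q at ∞ and q^(1/2) at 0. The quotient of a cusp form
by it is thus holomorphic, of weight 0 and bounded at the cusps, hence constant
(`CuspFormGamma1.exists_eq_smul`). The coefficient of q in the theta series comes from the 24
vectors of norm 2, which contribute -48, and so the sum over the `m`-th shell is -48 τ₂(m)
(`tau2_eq_sum`). -/

/-- The three translates `f`, `f ∣ S`, `f ∣ S ∣ T`, indexed by the non-zero rows modulo `2`. -/
noncomputable def rowTranslate (k : ℤ) (f : ℍ → ℂ) (v : Fin 2 → ZMod 2) : ℍ → ℂ :=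
  if v = 0 then 0 else if v 0 = 0 then f else if v 1 = 0 then f ∣[k] S else (f ∣[k] S) ∣[k] T

lemma slash_S_S {k : ℤ} (hk : Even k) (f : ℍ → ℂ) : (f ∣[k] S) ∣[k] S = f := by
  rw [← SlashAction.slash_mul]
  have h : S * S = -1 := by
    ext i j; fin_cases i <;> fin_cases j <;> simp [coe_S]
  rw [h]
  ext z
  rw [SL_slash_apply, ModularGroup.SL_neg_smul, one_smul]
  simp [denom, hk.neg_one_zpow]

lemma slash_S_T_S {k : ℤ} {f : ℍ → ℂ} (hT : f ∣[k] T = f)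
    (hST : ((f ∣[k] S) ∣[k] T) ∣[k] T = f ∣[k] S) :
    ((f ∣[k] S) ∣[k] T) ∣[k] S = (f ∣[k] S) ∣[k] T := by
  have h : S * T * S = T⁻¹ * S * T⁻¹ := by
    ext i j; fin_cases i <;> fin_cases j <;> simp [coe_S, coe_T]
  have hT' : f ∣[k] T⁻¹ = f := by
    conv_lhs => rw [← hT]
    rw [← SlashAction.slash_mul, mul_inv_cancel, SlashAction.slash_one]
  rw [← SlashAction.slash_mul, ← SlashAction.slash_mul, ← mul_assoc, h, SlashAction.slash_mul,
    SlashAction.slash_mul, hT']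
  conv_lhs => rw [← hST]
  rw [← SlashAction.slash_mul _ T T⁻¹, mul_inv_cancel, SlashAction.slash_one]

/-- The elements for which the identity holds for all rows form a subgroup, so `S` and `T` suffice
and no generators of Γ₁(2) are needed. That group is the stabilizer of the row (0, 1), which gives
the invariance of `f`. -/
theorem rowTranslate_slash {k : ℤ} (hk : Even k) {f : ℍ → ℂ} (hT : f ∣[k] T = f)
    (hST : ((f ∣[k] S) ∣[k] T) ∣[k] T = f ∣[k] S) (γ : SL(2, ℤ)) (v : Fin 2 → ZMod 2) :
    rowTranslate k f v ∣[k] γ =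
      rowTranslate k f (Matrix.vecMul v (γ.1.map (Int.cast : ℤ → ZMod 2))) := by
  let H : Subgroup SL(2, ℤ) :=
    { carrier := {γ | ∀ v : Fin 2 → ZMod 2, rowTranslate k f v ∣[k] γ =
        rowTranslate k f (Matrix.vecMul v (γ.1.map (Int.cast : ℤ → ZMod 2)))}
      one_mem' := by
        intro v
        simp
      mul_mem' := by
        intro a b ha hb v
        rw [SlashAction.slash_mul, ha, hb, Matrix.vecMul_vecMul]
        congr 2
        ext i j
        simp [Matrix.mul_apply]
      inv_mem' := by
        intro a ha v
        have h := ha (Matrix.vecMul v (a⁻¹.1.map (Int.cast : ℤ → ZMod 2)))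
        rw [Matrix.vecMul_vecMul, ← Matrix.map_mul_intCast, ← Matrix.SpecialLinearGroup.coe_mul,
          inv_mul_cancel] at h
        have h1 : ((1 : SL(2, ℤ)).1.map (Int.cast : ℤ → ZMod 2)) = 1 := by simp
        rw [h1, Matrix.vecMul_one] at h
        rw [← h, ← SlashAction.slash_mul, mul_inv_cancel, SlashAction.slash_one] }
  have hS := slash_S_S hk f
  have hSTS := slash_S_T_S hT hST
  have h2 : (1 : ZMod 2) + 1 = 0 := by decide
  have hH : H = ⊤ := by
    rw [eq_top_iff, ← SpecialLinearGroup.SL2Z_generators, Subgroup.closure_le]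
    rintro _ (rfl | rfl) v
    -- A finite check: two generators, each acting on the four rows modulo 2.
    all_goals
      obtain ⟨a, b, rfl⟩ : ∃ a b, v = ![a, b] := ⟨v 0, v 1, by ext i; fin_cases i <;> rfl⟩
      obtain rfl | rfl : a = 0 ∨ a = 1 := by revert a; decide
      all_goals obtain rfl | rfl : b = 0 ∨ b = 1 := by revert b; decide
    all_goals
      simp [rowTranslate, Matrix.vecMul, dotProduct, Fin.sum_univ_two, coe_S, coe_T, h2,
        funext_iff, Fin.forall_fin_two, hS, hSTS, hT, hST]
  have : γ ∈ H := hH ▸ Subgroup.mem_top γ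
  exact this v

theorem slash_eq_of_mem_Gamma1_two {k : ℤ} (hk : Even k) {f : ℍ → ℂ} (hT : f ∣[k] T = f)
    (hST : ((f ∣[k] S) ∣[k] T) ∣[k] T = f ∣[k] S) {γ : SL(2, ℤ)} (hγ : γ ∈ Gamma1 2) :
    f ∣[k] γ = f := by
  have h := rowTranslate_slash hk hT hST γ ![0, 1]
  obtain ⟨-, h1, h2⟩ := (Gamma1_mem 2 γ).1 hγ
  have e : Matrix.vecMul ![0, 1] (γ.1.map (Int.cast : ℤ → ZMod 2)) = ![0, 1] := by
    ext i; fin_cases i <;> simp [Matrix.vecMul, dotProduct, h1, h2]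
  rw [e] at h
  simpa [rowTranslate] using h

/-- The only unit modulo 2 is 1, so Γ₀(2) = Γ₁(2). -/
lemma mem_Gamma1_two {γ : SL(2, ℤ)} (h : Even (γ 1 0)) : γ ∈ Gamma1 2 := by
  rw [Gamma1_mem]
  have hdet := γ.det_coe
  rw [Matrix.det_fin_two] at hdet
  have h0 : ((γ 1 0 : ℤ) : ZMod 2) = 0 := by
    rw [ZMod.intCast_zmod_eq_zero_iff_dvd]; exact_mod_cast h.two_dvd
  have := congrArg (Int.cast : ℤ → ZMod 2) hdet
  push_cast at this
  rw [h0] at this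
  refine ⟨?_, ?_, h0⟩ <;>
  · revert this
    generalize ((γ 0 0 : ℤ) : ZMod 2) = a
    generalize ((γ 1 1 : ℤ) : ZMod 2) = b
    generalize ((γ 0 1 : ℤ) : ZMod 2) = c
    revert a b c
    decide

/-- The coset is read off from the bottom row modulo 2, which is (0, 1), (1, 0) or (1, 1). -/
theorem exists_mem_Gamma1_two_mul (γ : SL(2, ℤ)) :
    ∃ δ ∈ Gamma1 2, γ = δ ∨ γ = δ * S ∨ γ = δ * S * T := by
  by_cases hc : Even (γ 1 0)
  · exact ⟨γ, mem_Gamma1_two hc, .inl rfl⟩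
  by_cases hd : Even (γ 1 1)
  · refine ⟨γ * S⁻¹, mem_Gamma1_two ?_, .inr (.inl (by group))⟩
    simpa [Matrix.mul_apply, Fin.sum_univ_two, Matrix.SpecialLinearGroup.coe_inv, coe_S,
      Matrix.adjugate_fin_two] using hd
  · refine ⟨γ * T⁻¹ * S⁻¹, mem_Gamma1_two ?_, .inr (.inr (by group))⟩
    have : Even (γ 1 0 - γ 1 1) := by grind
    simpa [Matrix.mul_apply, Fin.sum_univ_two, Matrix.SpecialLinearGroup.coe_inv, coe_S,
      coe_T_inv, Matrix.adjugate_fin_two, sub_eq_add_neg, add_comm] using this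

/-- A property of functions on `ℍ` holds for all translates of a form on `Γ₁(2)` as soon as it
holds for three of them. -/
theorem forall_slash_of_Gamma1_two {k : ℤ} {f : ℍ → ℂ} (hf : ∀ γ ∈ Gamma1 2, f ∣[k] γ = f)
    {p : (ℍ → ℂ) → Prop} (h1 : p f) (h2 : p (f ∣[k] S)) (h3 : p ((f ∣[k] S) ∣[k] T))
    (γ : SL(2, ℤ)) : p (f ∣[k] γ) := by
  obtain ⟨δ, hδ, rfl | rfl | rfl⟩ := exists_mem_Gamma1_two_mul γ
  · rwa [hf _ hδ]
  · rwa [SlashAction.slash_mul, hf _ hδ]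
  · rwa [SlashAction.slash_mul, SlashAction.slash_mul, hf _ hδ]

lemma slash_T_apply (k : ℤ) (f : ℍ → ℂ) (z : ℍ) : (f ∣[k] T) z = f ((1 : ℝ) +ᵥ z) := by
  rw [SL_slash_apply, modular_T_smul]
  simp [denom, coe_T]

lemma slash_S_apply (k : ℤ) (f : ℍ → ℂ) (z : ℍ) :
    (f ∣[k] S) z = f (S • z) * (z : ℂ) ^ (-k) := by
  rw [SL_slash_apply, denom_S]

lemma isZeroAtImInfty_slash_T {k : ℤ} {f : ℍ → ℂ} (hf : IsZeroAtImInfty f) :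
    IsZeroAtImInfty (f ∣[k] T) := by
  apply IsZeroAtImInfty.slash _ _ hf
  simp [coe_T]

end LatticeDesign

end

/-! ### The eta product as a cusp form -/

section

open ModularForm UpperHalfPlane CongruenceSubgroup ModularGroup MatrixGroups Filter Asymptotics
open scoped Topology

namespace LatticeDesign

lemma eta_add_one (z : ℂ) :
    eta (z + 1) = Complex.exp (2 * Real.pi * Complex.I / 24) * eta z := by
  have h1 : ∀ n, eta_q n (z + 1) = eta_q n z := by
    intro n
    simp only [eta_q]
    congr 1
    simp only [Function.Periodic.qParam]
    rw [Complex.exp_eq_exp_iff_exists_int]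
    exact ⟨1, by push_cast; ring⟩
  simp only [eta, h1, ← mul_assoc]
  congr 1
  simp only [Function.Periodic.qParam]
  rw [← Complex.exp_add]
  congr 1
  push_cast
  ring

lemma eta_pow_eight_add_one (z : ℂ) :
    eta (z + 1) ^ 8 = Complex.exp (2 * Real.pi * Complex.I / 3) * eta z ^ 8 := by
  rw [eta_add_one, mul_pow, ← Complex.exp_nat_mul]
  congr 2
  push_cast
  ring

lemma exp_two_pi_I_div_three_pow : Complex.exp (2 * Real.pi * Complex.I / 3) ^ 3 = 1 := by
  rw [← Complex.exp_nat_mul, ← Complex.exp_two_pi_mul_I]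
  congr 1
  push_cast
  ring

lemma csqrt_pow_eight {z : ℂ} (hz : z ≠ 0) : Complex.sqrt z ^ 8 = z ^ 4 := by
  rw [_root_.sqrt_eq_exp hz, ← Complex.exp_nat_mul]
  rw [show ((8 : ℕ) : ℂ) * (Complex.log z / 2) = (4 : ℕ) * Complex.log z by push_cast; ring,
    Complex.exp_nat_mul, Complex.exp_log hz]

/-- The eighth power removes the choice of square root, and the constant it leaves is I⁴ = 1. -/
lemma eta_pow_eight_neg_inv {z : ℂ} (hz : 0 < z.im) : eta (-1 / z) ^ 8 = z ^ 4 * eta z ^ 8 := by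
  have h0 : z ≠ 0 := by rintro rfl; simp at hz
  have h := eta_comp_eq_csqrt_I_inv hz
  simp only [Function.comp, Pi.smul_apply, Pi.mul_apply, smul_eq_mul] at h
  rw [h, mul_pow, mul_pow, inv_pow, csqrt_pow_eight h0, csqrt_pow_eight Complex.I_ne_zero]
  simp

/-- The function `η(z)⁸ η(z/2)⁸ / 16`, the translate of `η(z)⁸ η(2z)⁸` at the cusp `0`. -/
noncomputable def etaProductDual (z : ℍ) : ℂ :=
  eta (z : ℂ) ^ 8 * eta ((z : ℂ) / 2) ^ 8 / 16

lemma etaProduct_slash_T : etaProduct ∣[(8 : ℤ)] T = etaProduct := by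
  ext z
  rw [slash_T_apply]
  simp only [etaProduct, coe_vadd, Complex.ofReal_one]
  rw [add_comm (1 : ℂ), eta_pow_eight_add_one,
    show 2 * ((z : ℂ) + 1) = (2 * z + 1) + 1 by ring, eta_pow_eight_add_one, eta_pow_eight_add_one]
  linear_combination eta (z : ℂ) ^ 8 * eta (2 * (z : ℂ)) ^ 8 * exp_two_pi_I_div_three_pow

lemma coe_S_smul (z : ℍ) : ((S • z : ℍ) : ℂ) = -1 / z := by
  rw [modular_S_smul]
  simp [neg_div, inv_neg]

lemma etaProduct_slash_S : etaProduct ∣[(8 : ℤ)] S = etaProductDual := by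
  ext z
  rw [slash_S_apply]
  simp only [etaProduct, etaProductDual, coe_S_smul]
  have h2 : 0 < ((z : ℂ) / 2).im := by
    have := z.im_pos
    simpa using this
  rw [show 2 * (-1 / (z : ℂ)) = -1 / ((z : ℂ) / 2) by field_simp, eta_pow_eight_neg_inv z.im_pos,
    eta_pow_eight_neg_inv h2]
  have := z.ne_zero
  rw [zpow_neg]
  norm_cast
  field_simp
  ring

lemma etaProductDual_slash_T_T :
    (etaProductDual ∣[(8 : ℤ)] T) ∣[(8 : ℤ)] T = etaProductDual := by
  ext z
  rw [slash_T_apply, slash_T_apply]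
  simp only [etaProductDual, coe_vadd, Complex.ofReal_one]
  rw [show (1 : ℂ) + (1 + z) = (z + 1) + 1 by ring, eta_pow_eight_add_one, eta_pow_eight_add_one,
    show ((z : ℂ) + 1 + 1) / 2 = z / 2 + 1 by ring, eta_pow_eight_add_one]
  linear_combination (eta (z : ℂ) ^ 8 * eta ((z : ℂ) / 2) ^ 8 / 16) * exp_two_pi_I_div_three_pow

/-- Multiplication by a positive real number on the upper half-plane. -/
noncomputable def scale (r : ℝ) (hr : 0 < r) (z : ℍ) : ℍ :=
  ⟨r * z, by simpa using mul_pos hr z.im_pos⟩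

@[simp] lemma coe_scale (r : ℝ) (hr : 0 < r) (z : ℍ) : (scale r hr z : ℂ) = r * z := rfl

@[simp] lemma im_scale (r : ℝ) (hr : 0 < r) (z : ℍ) : (scale r hr z).im = r * z.im := by
  simp [← coe_im]

lemma tendsto_scale (r : ℝ) (hr : 0 < r) : Tendsto (scale r hr) atImInfty atImInfty := by
  rw [atImInfty, tendsto_comap_iff]
  refine Tendsto.congr (f₁ := fun z : ℍ ↦ r * z.im) (fun z ↦ by simp) ?_
  exact tendsto_comap.const_mul_atTop hr

/-- Since Δ = η²⁴, cubing reduces the growth and non-vanishing of the eta product to those of Δ. -/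
lemma etaProduct_cube (z : ℍ) :
    etaProduct z ^ 3 = discriminant z * discriminant (scale 2 two_pos z) := by
  simp only [etaProduct, discriminant, coe_scale, Complex.ofReal_ofNat]
  ring

lemma etaProductDual_cube (z : ℍ) : etaProductDual z ^ 3 =
    discriminant z * discriminant (scale (1 / 2) one_half_pos z) / 4096 := by
  simp only [etaProductDual, discriminant, coe_scale]
  rw [show (((1 / 2 : ℝ) : ℂ) * z) = (z : ℂ) / 2 by push_cast; ring]
  ring

/-- A lower bound on the eta product: it vanishes at ∞ to order at most that of q. The cube is of
the size of q · q² = q³. -/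
lemma exp_isBigO_etaProduct :
    (fun z : ℍ ↦ Real.exp (-2 * Real.pi * z.im)) =O[atImInfty] etaProduct := by
  apply IsBigO.of_pow (n := 3) (by norm_num)
  have h := exp_isBigO_discriminant.mul
    (exp_isBigO_discriminant.comp_tendsto (tendsto_scale 2 two_pos))
  refine (h.congr' (.of_forall fun z ↦ ?_) (.of_forall fun z ↦ ?_))
  · simp only [Function.comp, im_scale, Pi.pow_apply]
    rw [← Real.exp_add, ← Real.exp_nat_mul]
    congr 1
    push_cast; ring
  · simp [etaProduct_cube]

/-- The same bound at the cusp 0, where the cube is of the size of q · q^(1/2), giving order at most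
that of q^(1/2). -/
lemma exp_isBigO_etaProductDual :
    (fun z : ℍ ↦ Real.exp (-Real.pi * z.im)) =O[atImInfty] etaProductDual := by
  apply IsBigO.of_pow (n := 3) (by norm_num)
  have h := (exp_isBigO_discriminant.mul
    (exp_isBigO_discriminant.comp_tendsto (tendsto_scale (1 / 2) one_half_pos)))
  have h' := h.trans (isBigO_self_const_mul (c := (1 / 4096 : ℂ)) (by norm_num) _ _)
  refine (h'.congr' (.of_forall fun z ↦ ?_) (.of_forall fun z ↦ ?_))
  · simp only [Function.comp, im_scale, Pi.pow_apply]
    rw [← Real.exp_add, ← Real.exp_nat_mul]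
    congr 1
    push_cast; ring
  · simp only [Pi.pow_apply, etaProductDual_cube, Function.comp]
    ring

lemma isZeroAtImInfty_of_cube {f : ℍ → ℂ} (h : IsZeroAtImInfty (fun z ↦ f z ^ 3)) :
    IsZeroAtImInfty f := by
  have h' : Tendsto (fun z ↦ f z ^ 3) atImInfty (𝓝 0) := h
  rw [tendsto_zero_iff_norm_tendsto_zero] at h'
  have h2 := h'.rpow_const (p := 1 / 3) (.inr (by norm_num))
  rw [Real.zero_rpow (by norm_num)] at h2
  refine tendsto_zero_iff_norm_tendsto_zero.2 (h2.congr fun z ↦ ?_)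
  rw [norm_pow, ← Real.rpow_natCast, ← Real.rpow_mul (norm_nonneg _)]
  norm_num

lemma isZeroAtImInfty_discriminant_mul_scale (r : ℝ) (hr : 0 < r) :
    Tendsto (fun z ↦ discriminant z * discriminant (scale r hr z)) atImInfty (𝓝 0) := by
  have h : Tendsto discriminant atImInfty (𝓝 0) := discriminant_isZeroAtImInfty
  simpa using h.mul (h.comp (tendsto_scale r hr))

lemma isZeroAtImInfty_etaProduct : IsZeroAtImInfty etaProduct := by
  apply isZeroAtImInfty_of_cube
  simp only [etaProduct_cube]
  exact isZeroAtImInfty_discriminant_mul_scale 2 two_pos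

lemma isZeroAtImInfty_etaProductDual : IsZeroAtImInfty etaProductDual := by
  apply isZeroAtImInfty_of_cube
  simp only [etaProductDual_cube]
  have := (isZeroAtImInfty_discriminant_mul_scale (1 / 2) one_half_pos).div_const 4096
  simpa [IsZeroAtImInfty, ZeroAtFilter] using this

open scoped Manifold in
lemma mdifferentiable_etaProduct : MDiff etaProduct := by
  rw [UpperHalfPlane.mdifferentiable_iff]
  have h2 : ∀ z : ℂ, 0 < z.im → DifferentiableAt ℂ (fun z ↦ eta (2 * z)) z := by
    intro z hz
    refine DifferentiableAt.comp z (g := eta) (f := fun z ↦ 2 * z)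
      (differentiableAt_eta_of_mem_upperHalfPlaneSet ?_) (by fun_prop)
    simpa using hz
  refine .congr (f := fun z ↦ eta z ^ 8 * eta (2 * z) ^ 8) (fun z hz ↦ ?_) fun z hz ↦ ?_
  · exact (((differentiableAt_eta_of_mem_upperHalfPlaneSet hz).pow 8).mul
      ((h2 z hz).pow 8)).differentiableWithinAt
  · simp [etaProduct, ofComplex_apply_of_im_pos hz]

open scoped Manifold in
/-- A function with the right behaviour under `S` and `T`, vanishing at the two cusps, is a cusp
form on `Γ₁(2)`. -/
noncomputable def cuspFormOfGenerators {k : ℤ} (hk : Even k) (f : ℍ → ℂ) (hf : MDiff f)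
    (hT : f ∣[k] T = f) (hST : ((f ∣[k] S) ∣[k] T) ∣[k] T = f ∣[k] S)
    (h0 : IsZeroAtImInfty f) (h1 : IsZeroAtImInfty (f ∣[k] S)) : CuspFormGamma1 2 k where
  toFun := f
  slash_action_eq' := by
    rintro _ ⟨γ, hγ, rfl⟩
    exact slash_eq_of_mem_Gamma1_two hk hT hST hγ
  holo' := hf
  zero_at_cusps' {c} hc := by
    rw [Subgroup.IsArithmetic.isCusp_iff_isCusp_SL2Z] at hc
    rw [OnePoint.isZeroAt_iff_forall_SL2Z hc]
    intro γ _
    exact forall_slash_of_Gamma1_two (fun γ hγ ↦ slash_eq_of_mem_Gamma1_two hk hT hST hγ) h0 h1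
      (isZeroAtImInfty_slash_T h1) γ

lemma even_eight : Even (8 : ℤ) := ⟨4, rfl⟩

/-- `η(z)⁸ η(2z)⁸` as a cusp form of weight `8` on `Γ₁(2)`. -/
noncomputable def etaCuspForm : CuspFormGamma1 2 8 :=
  cuspFormOfGenerators even_eight etaProduct mdifferentiable_etaProduct etaProduct_slash_T
    (by rw [etaProduct_slash_S, etaProductDual_slash_T_T]) isZeroAtImInfty_etaProduct
    (by rw [etaProduct_slash_S]; exact isZeroAtImInfty_etaProductDual)

@[simp] lemma coe_etaCuspForm : ⇑etaCuspForm = etaProduct := rfl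

lemma etaProduct_ne_zero (z : ℍ) : etaProduct z ≠ 0 := by
  intro h
  have := etaProduct_cube z
  rw [h] at this
  simp [discriminant_ne_zero] at this

lemma one_mem_strictPeriods_Gamma1 (N : ℕ) :
    (1 : ℝ) ∈ ((Gamma1 N).map (Matrix.SpecialLinearGroup.mapGL ℝ)).strictPeriods := by
  simp

end LatticeDesign

end

/-! ### Cusp forms of weight 8 on Γ₁(2) form a line -/

section

open ModularForm UpperHalfPlane CongruenceSubgroup ModularGroup MatrixGroups Filter Asymptotics
open scoped Topology

namespace LatticeDesign

lemma etaProduct_eq_qParam_mul (z : ℍ) : etaProduct z = Function.Periodic.qParam 1 z *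
    ((∏' i, (1 - Function.Periodic.qParam 1 z ^ (i + 1))) ^ 8 *
      (∏' i, (1 - (Function.Periodic.qParam 1 z ^ 2) ^ (i + 1))) ^ 8) := by
  have h2 : Function.Periodic.qParam 1 (2 * z) = Function.Periodic.qParam 1 z ^ 2 := by
    simp only [Function.Periodic.qParam, ← Complex.exp_nat_mul]
    congr 1
    push_cast; ring
  -- The two prefactors have exponents 8/24 and 16/24, which add up to 1.
  have h24 : Function.Periodic.qParam 24 z ^ 8 * Function.Periodic.qParam 24 (2 * z) ^ 8 =
      Function.Periodic.qParam 1 z := by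
    simp only [Function.Periodic.qParam, ← Complex.exp_nat_mul, ← Complex.exp_add]
    congr 1
    push_cast; ring
  simp only [etaProduct, eta, eta_q, h2, mul_pow]
  rw [← h24]
  ring

/-- The function `∏ (1 - qⁿ)⁸ (1 - q²ⁿ)⁸` of `q`. -/
noncomputable def etaProductUnit (q : ℂ) : ℂ :=
  (∏' i, (1 - q ^ (i + 1))) ^ 8 * (∏' i, (1 - (q ^ 2) ^ (i + 1))) ^ 8

lemma differentiableOn_etaProductUnit :
    DifferentiableOn ℂ etaProductUnit (Metric.ball 0 1) := by
  refine (differentiableOn_tprod_one_sub_pow.fun_pow 8).mul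
    (DifferentiableOn.fun_pow (DifferentiableOn.comp (f := fun q : ℂ ↦ q ^ 2)
      (t := Metric.ball 0 1) differentiableOn_tprod_one_sub_pow (by fun_prop) ?_) 8)
  intro q hq
  simp only [mem_ball_zero_iff, norm_pow] at hq ⊢
  exact pow_lt_one₀ (norm_nonneg _) hq two_ne_zero

lemma etaProduct_cuspFunction_eqOn : Set.EqOn (cuspFunction 1 etaProduct)
    (fun q ↦ q * etaProductUnit q) (Metric.ball 0 1) := by
  intro q hq
  by_cases hq0 : q = 0
  · simpa [hq0] using isZeroAtImInfty_etaProduct.cuspFunction_apply_zero one_pos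
  · have him := Function.Periodic.im_invQParam_pos_of_norm_lt_one one_pos
      (by simpa [dist_zero_right] using hq) hq0
    simp [cuspFunction, Function.Periodic.cuspFunction_eq_of_nonzero 1 _ hq0,
      ofComplex_apply_of_im_pos him, etaProduct_eq_qParam_mul ⟨_, him⟩,
      Function.Periodic.qParam_right_inv one_ne_zero hq0, etaProductUnit]

lemma etaProduct_qExpansion_coeff_one : (qExpansion 1 etaProduct).coeff 1 = 1 := by
  have hmem : (0 : ℂ) ∈ Metric.ball (0 : ℂ) 1 := Metric.mem_ball_self one_pos
  calc (qExpansion 1 etaProduct).coeff 1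
      = derivWithin (cuspFunction 1 etaProduct) (Metric.ball 0 1) 0 := by
        simp [qExpansion_coeff, ← derivWithin_of_isOpen Metric.isOpen_ball hmem]
    _ = derivWithin (fun q ↦ q * etaProductUnit q) (Metric.ball 0 1) 0 :=
        derivWithin_congr etaProduct_cuspFunction_eqOn (etaProduct_cuspFunction_eqOn hmem)
    _ = 1 := by
        rw [derivWithin_fun_mul differentiableWithinAt_fun_id
          (differentiableOn_etaProductUnit _ hmem),
          derivWithin_id' _ _ (Metric.isOpen_ball.uniqueDiffWithinAt hmem)]
        simp [etaProductUnit]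

lemma CuspFormGamma1.slash_eq {N : ℕ} {k : ℤ} (g : CuspFormGamma1 N k) {γ : SL(2, ℤ)}
    (hγ : γ ∈ Gamma1 N) : ⇑g ∣[k] γ = g :=
  SlashInvariantFormClass.slash_action_eq g _ ⟨γ, hγ, rfl⟩

lemma CuspFormGamma1.isZeroAtImInfty_slash {N : ℕ} [NeZero N] {k : ℤ} (g : CuspFormGamma1 N k)
    (γ : SL(2, ℤ)) : IsZeroAtImInfty (⇑g ∣[k] γ) := by
  have hc : IsCusp (Matrix.SpecialLinearGroup.mapGL ℝ γ • OnePoint.infty) 𝒮ℒ :=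
    isCusp_SL2Z_iff'.2 ⟨γ, rfl⟩
  have hc' := (Subgroup.IsArithmetic.isCusp_iff_isCusp_SL2Z
    ((Gamma1 N).map (Matrix.SpecialLinearGroup.mapGL ℝ))).2 hc
  exact (OnePoint.isZeroAt_iff_forall_SL2Z hc).1 (CuspFormClass.zero_at_cusps g hc') γ rfl

/-- The cusp 0 has width 2. -/
lemma T_sq_mem_conj : S * T * T * S⁻¹ ∈ Gamma1 2 := by
  apply mem_Gamma1_two
  simp [Matrix.mul_apply, Fin.sum_univ_two, Matrix.SpecialLinearGroup.coe_inv, coe_S,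
      coe_T, Matrix.adjugate_fin_two]

lemma CuspFormGamma1.slash_S_T_T {k : ℤ} (g : CuspFormGamma1 2 k) :
    ((⇑g ∣[k] S) ∣[k] T) ∣[k] T = ⇑g ∣[k] S := by
  have h := g.slash_eq T_sq_mem_conj
  conv_rhs => rw [← h]
  simp only [← SlashAction.slash_mul]
  congr 1
  group

lemma periodic_comp_ofComplex_of_vadd {f : ℍ → ℂ} {h : ℝ} (hf : ∀ z : ℍ, f (h +ᵥ z) = f z) :
    Function.Periodic (f ∘ ofComplex) h := by
  intro w
  by_cases! hw : 0 < w.im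
  · have : 0 < (w + h).im := by simp [hw]
    simp only [Function.comp_apply, ofComplex_apply_of_im_pos this, ofComplex_apply_of_im_pos hw]
    convert! hf ⟨w, hw⟩ using 2
    ext
    simp [add_comm]
  · have : (w + h).im ≤ 0 := by simpa using hw
    simp [ofComplex_apply_of_im_nonpos this, ofComplex_apply_of_im_nonpos hw]

open scoped Manifold in
-- At the cusp 0 a form is a series in q^(1/2), so vanishing there forces decay at the rate of
-- q^(1/2), exactly what `exp_isBigO_etaProductDual` can absorb.
lemma CuspFormGamma1.isBigO_slash_S {k : ℤ} (g : CuspFormGamma1 2 k) :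
    (⇑g ∣[k] S) =O[atImInfty] fun z : ℍ ↦ Real.exp (-Real.pi * z.im) := by
  have h0 := g.isZeroAtImInfty_slash S
  have hhol : MDiff (⇑g ∣[k] S) := (CuspFormClass.holo g).slash k _
  have hper : Function.Periodic ((⇑g ∣[k] S) ∘ ofComplex) (2 : ℝ) := by
    apply periodic_comp_ofComplex_of_vadd
    intro z
    have := congrFun g.slash_S_T_T z
    rw [slash_T_apply, slash_T_apply] at this
    rw [← this, vadd_vadd]
    norm_num
  have := h0.exp_decay_atImInfty two_pos hper hhol h0.isBoundedAtImInfty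
  refine this.congr_right fun z ↦ ?_
  congr 1
  ring

lemma CuspFormGamma1.isBigO_exp {N : ℕ} [NeZero N] {k : ℤ} (g : CuspFormGamma1 N k) :
    (g : ℍ → ℂ) =O[atImInfty] fun z : ℍ ↦ Real.exp (-2 * Real.pi * z.im) := by
  simpa using CuspFormClass.exp_decay_atImInfty (h := 1) g one_pos
    (one_mem_strictPeriods_Gamma1 N)

lemma isBoundedAtImInfty_div {f g : ℍ → ℂ} (h : g =O[atImInfty] f) :
    IsBoundedAtImInfty (g / f) :=
  (div_isBoundedUnder_of_isBigO h).isBigO_one ℝ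

lemma CuspFormGamma1.div_slash (g : CuspFormGamma1 2 8) (γ : SL(2, ℤ)) :
    (⇑g / etaProduct) ∣[(0 : ℤ)] γ = (⇑g ∣[(8 : ℤ)] γ) / (etaProduct ∣[(8 : ℤ)] γ) :=
  div_slash_SL2 8 8 γ _ _

/-- The quotient of a cusp form of weight `8` on `Γ₁(2)` by `η(z)⁸ η(2z)⁸`. -/
noncomputable def CuspFormGamma1.divEta (g : CuspFormGamma1 2 8) :
    ModularForm ((Gamma1 2).map (Matrix.SpecialLinearGroup.mapGL ℝ)) 0 where
  toFun := g / etaProduct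
  slash_action_eq' := by
    rintro _ ⟨γ, hγ, rfl⟩
    change (⇑g / etaProduct) ∣[(0 : ℤ)] γ = _
    rw [g.div_slash, g.slash_eq hγ, ← coe_etaCuspForm, etaCuspForm.slash_eq hγ]
  holo' := (CuspFormClass.holo g).div mdifferentiable_etaProduct etaProduct_ne_zero
  bdd_at_cusps' {c} hc := by
    rw [Subgroup.IsArithmetic.isCusp_iff_isCusp_SL2Z] at hc
    rw [OnePoint.isBoundedAt_iff_forall_SL2Z hc]
    intro γ _
    -- The translates by `S` and `S * T` both describe the cusp 0, so this one bound serves for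
    -- both.
    have hS : IsBoundedAtImInfty ((⇑g / etaProduct) ∣[(0 : ℤ)] S) := by
      rw [g.div_slash, etaProduct_slash_S]
      exact isBoundedAtImInfty_div (g.isBigO_slash_S.trans exp_isBigO_etaProductDual)
    refine forall_slash_of_Gamma1_two (fun γ hγ ↦ ?_) ?_ hS ?_ γ
    · rw [g.div_slash, g.slash_eq hγ, ← coe_etaCuspForm, etaCuspForm.slash_eq hγ]
    · exact isBoundedAtImInfty_div (g.isBigO_exp.trans exp_isBigO_etaProduct)
    · apply IsBoundedAtImInfty.slash _ _ hS
      simp [coe_T]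

theorem CuspFormGamma1.exists_eq_smul (g : CuspFormGamma1 2 8) :
    ∃ c : ℂ, g = c • etaCuspForm := by
  obtain ⟨c, hc⟩ := ModularForm.eq_const_of_weight_zero g.divEta
  refine ⟨c, CuspForm.ext fun z ↦ ?_⟩
  have := congrFun hc z
  change g z / etaProduct z = c at this
  rw [div_eq_iff (etaProduct_ne_zero z)] at this
  simpa using this

/-- The space of cusp forms of weight `8` on `Γ₁(2)` is spanned by `η(z)⁸ η(2z)⁸`. -/
theorem CuspFormGamma1.eq_coeff_smul (g : CuspFormGamma1 2 8) :
    g = (qExpansion 1 g).coeff 1 • etaCuspForm := by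
  obtain ⟨c, rfl⟩ := g.exists_eq_smul
  congr 1
  have := ModularForm.qExpansion_smul one_pos (one_mem_strictPeriods_Gamma1 2) c etaCuspForm
  rw [FunLike.coe_smul, this, PowerSeries.coeff_smul, coe_etaCuspForm,
    etaProduct_qExpansion_coeff_one, smul_eq_mul, mul_one]

theorem isNormalized_etaCuspForm : IsNormalized etaCuspForm :=
  etaProduct_qExpansion_coeff_one

theorem CuspFormGamma1.eq_of_isNormalized {g : CuspFormGamma1 2 8} (hg : IsNormalized g) :
    g = etaCuspForm := by
  rw [g.eq_coeff_smul, show (qExpansion 1 g).coeff 1 = 1 from hg, one_smul]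

lemma hasSum_tau2 (z : ℍ) :
    HasSum (fun m : ℕ ↦ tau2 m * Complex.exp (2 * Real.pi * Complex.I * z) ^ m) (etaProduct z) := by
  have h := UpperHalfPlane.hasSum_qExpansion one_pos
    (SlashInvariantFormClass.periodic_comp_ofComplex etaCuspForm (one_mem_strictPeriods_Gamma1 2))
    (CuspFormClass.holo etaCuspForm) isZeroAtImInfty_etaProduct.isBoundedAtImInfty z
  simpa [Function.Periodic.qParam, tau2] using h

lemma tau2_zero : tau2 0 = 0 :=
  CuspFormClass.qExpansion_coeff_zero etaCuspForm one_pos (one_mem_strictPeriods_Gamma1 2)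

theorem hasSum_tau2_succ (z : ℍ) :
    HasSum (fun m : ℕ ↦ tau2 (m + 1) * Complex.exp (2 * Real.pi * Complex.I * z) ^ (m + 1))
      (eta (z : ℂ) ^ 8 * eta (2 * (z : ℂ)) ^ 8) := by
  have h := (hasSum_nat_add_iff' 1).2 (hasSum_tau2 z)
  simpa [tau2_zero, etaProduct] using h

end LatticeDesign

end

/-! ### A differential expression taking weight 1/2 to weight 8 -/

section

open UpperHalfPlane ModularGroup Filter Asymptotics
open scoped Topology

namespace LatticeDesign

/-- The differential expression `g³g''' - 15g²g'g'' + 30g(g')³`. On forms of weight `1/2` it takes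
values in forms of weight `8`. -/
noncomputable def bracket (g : ℂ → ℂ) (z : ℂ) : ℂ :=
  g z ^ 3 * deriv (deriv (deriv g)) z - 15 * g z ^ 2 * deriv g z * deriv (deriv g) z +
    30 * g z * deriv g z ^ 3

lemma bracket_comp_add_const (g : ℂ → ℂ) (a z : ℂ) :
    bracket (fun z ↦ g (z + a)) z = bracket g (z + a) := by
  have h : ∀ f : ℂ → ℂ, deriv (fun z ↦ f (z + a)) = fun z ↦ deriv f (z + a) :=
    fun f ↦ funext fun z ↦ deriv_comp_add_const ..
  simp only [bracket, h]

lemma bracket_const_mul (g : ℂ → ℂ) (c z : ℂ) :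
    bracket (fun z ↦ c * g z) z = c ^ 4 * bracket g z := by
  have h : ∀ f : ℂ → ℂ, deriv (fun z ↦ c * f z) = fun z ↦ c * deriv f z :=
    fun f ↦ funext fun z ↦ deriv_const_mul_field ..
  simp only [bracket, h]
  ring

lemma isOpen_im_pos : IsOpen {z : ℂ | 0 < z.im} := isOpen_upperHalfPlaneSet

lemma bracket_congr {g h : ℂ → ℂ} (H : Set.EqOn g h {z : ℂ | 0 < z.im}) {z : ℂ}
    (hz : 0 < z.im) : bracket g z = bracket h z := by
  have h0 : g =ᶠ[𝓝 z] h := H.eventuallyEq_of_mem (isOpen_im_pos.mem_nhds hz)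
  simp only [bracket, h0.eq_of_nhds, h0.deriv.eq_of_nhds, h0.deriv.deriv.eq_of_nhds,
    h0.deriv.deriv.deriv.eq_of_nhds]

lemma differentiableOn_deriv_im_pos {g : ℂ → ℂ} (hg : DifferentiableOn ℂ g {z : ℂ | 0 < z.im}) :
    DifferentiableOn ℂ (deriv g) {z : ℂ | 0 < z.im} := hg.deriv isOpen_im_pos

lemma differentiableOn_bracket {g : ℂ → ℂ} (hg : DifferentiableOn ℂ g {z : ℂ | 0 < z.im}) :
    DifferentiableOn ℂ (bracket g) {z : ℂ | 0 < z.im} := by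
  have h1 := differentiableOn_deriv_im_pos hg
  have h2 := differentiableOn_deriv_im_pos h1
  have h3 := differentiableOn_deriv_im_pos h2
  unfold bracket
  fun_prop

lemma neg_one_div_im_pos {z : ℂ} (hz : 0 < z.im) : 0 < (-1 / z).im := by
  have := (S • (⟨z, hz⟩ : ℍ)).im_pos
  rwa [← coe_im, coe_S_smul] at this

/-- The branch of `√(-iz)` that is the automorphy factor of Jacobi's theta function. -/
noncomputable def thetaFactor (z : ℂ) : ℂ := (-Complex.I * z) ^ (1 / 2 : ℂ)

lemma ne_zero_of_im_pos {z : ℂ} (hz : 0 < z.im) : z ≠ 0 := by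
  rintro rfl; simp at hz

lemma thetaFactor_sq {z : ℂ} : thetaFactor z ^ 2 = -Complex.I * z := by
  rw [thetaFactor, ← Complex.cpow_nat_mul]
  norm_num

lemma thetaFactor_pow_four {z : ℂ} : thetaFactor z ^ 4 = - z ^ 2 := by
  rw [show 4 = 2 * 2 by norm_num, pow_mul, thetaFactor_sq, mul_pow]
  simp

lemma hasDerivAt_thetaFactor {z : ℂ} (hz : 0 < z.im) :
    HasDerivAt thetaFactor (thetaFactor z / (2 * z)) z := by
  have h0 := ne_zero_of_im_pos hz
  have hne : -Complex.I * z ≠ 0 := mul_ne_zero (by simp) h0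
  have h1 : HasDerivAt (fun z : ℂ ↦ -Complex.I * z) (-Complex.I) z := by
    simpa using (hasDerivAt_id z).const_mul (-Complex.I)
  have h := h1.cpow_const (c := 1 / 2) (by left; simpa using hz)
  convert! h using 1
  rw [Complex.cpow_sub _ _ hne, Complex.cpow_one, thetaFactor]
  have := Complex.I_ne_zero
  field_simp

/-- Positive scaling does not change the argument, so the branch of the root is respected. It is
needed to compare the factors at z and z/4. -/
lemma thetaFactor_ofReal_mul {r : ℝ} (hr : 0 < r) {z : ℂ} (hz : 0 < z.im) :
    thetaFactor ((r ^ 2 : ℝ) * z) = r * thetaFactor z := by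
  have h0 := ne_zero_of_im_pos hz
  have hne : -Complex.I * z ≠ 0 := mul_ne_zero (by simp) h0
  have hr2 : (0 : ℝ) < r ^ 2 := by positivity
  have hne' : ((r ^ 2 : ℝ) : ℂ) * (-Complex.I * z) ≠ 0 :=
    mul_ne_zero (by exact_mod_cast hr2.ne') hne
  rw [thetaFactor, thetaFactor, mul_left_comm, Complex.cpow_def_of_ne_zero hne',
    Complex.cpow_def_of_ne_zero hne, Complex.log_ofReal_mul hr2 hne, Real.log_pow, add_mul,
    Complex.exp_add]
  congr 1
  rw [show ((((2 : ℕ) : ℝ) * Real.log r : ℝ) : ℂ) * (1 / 2) = (Real.log r : ℝ) by push_cast; ring,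
    ← Complex.ofReal_exp, Real.exp_log hr]

/-- Differentiating a transformation law of weight `1/2` under `z ↦ -1/z`. -/
lemma deriv_neg_one_div {G k : ℂ → ℂ} (hG : DifferentiableOn ℂ G {z : ℂ | 0 < z.im})
    (hk : DifferentiableOn ℂ k {z : ℂ | 0 < z.im})
    (H : ∀ z : ℂ, 0 < z.im → G (-1 / z) = thetaFactor z * k z) {z : ℂ} (hz : 0 < z.im) :
    deriv G (-1 / z) = thetaFactor z * (z ^ 2 * deriv k z + z / 2 * k z) := by
  have h0 := ne_zero_of_im_pos hz
  have hi : HasDerivAt (fun z : ℂ ↦ -1 / z) (1 / z ^ 2) z := by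
    have := (hasDerivAt_inv h0).neg
    convert! this using 1
    · ext x; simp [neg_div]
    · simp
  have hG' := (hG.differentiableAt (isOpen_im_pos.mem_nhds (neg_one_div_im_pos hz))).hasDerivAt
  have hk' := (hk.differentiableAt (isOpen_im_pos.mem_nhds hz)).hasDerivAt
  have h1 := hG'.comp z hi
  have h2 := (hasDerivAt_thetaFactor hz).mul hk'
  have heq : (G ∘ fun z : ℂ ↦ -1 / z) =ᶠ[𝓝 z] (thetaFactor * k) := by
    filter_upwards [isOpen_im_pos.mem_nhds hz] with w hw using H w hw
  have h3 := (h1.congr_of_eventuallyEq heq.symm).unique h2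
  field_simp at h3 ⊢
  linear_combination h3

/-- Each derivative of the transformation law adds terms with lower derivatives of `h`. In the
combination with coefficients 1, -15, 30 these all cancel; what remains has the factor z⁶ from the
derivatives and -z² from the fourth power of the theta factor. Allowing `g ≠ h` covers the passage
from θ(z + 1) to θ₂. -/
theorem bracket_neg_one_div {g h : ℂ → ℂ} (hg : DifferentiableOn ℂ g {z : ℂ | 0 < z.im})
    (hh : DifferentiableOn ℂ h {z : ℂ | 0 < z.im})
    (H : ∀ z : ℂ, 0 < z.im → g (-1 / z) = thetaFactor z * h z) {z : ℂ} (hz : 0 < z.im) :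
    bracket g (-1 / z) = - (z ^ 8 * bracket h z) := by
  have g1 := differentiableOn_deriv_im_pos hg
  have g2 := differentiableOn_deriv_im_pos g1
  have h1 := differentiableOn_deriv_im_pos hh
  have h2 := differentiableOn_deriv_im_pos h1
  have hd : ∀ {f : ℂ → ℂ}, DifferentiableOn ℂ f {z : ℂ | 0 < z.im} → ∀ w : ℂ, 0 < w.im →
      HasDerivAt f (deriv f w) w := fun hf w hw ↦
    (hf.differentiableAt (isOpen_im_pos.mem_nhds hw)).hasDerivAt
  have H1 : ∀ w : ℂ, 0 < w.im → deriv g (-1 / w) =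
      thetaFactor w * (w ^ 2 * deriv h w + w / 2 * h w) := fun w hw ↦ deriv_neg_one_div hg hh H hw
  have H2 : ∀ w : ℂ, 0 < w.im → deriv (deriv g) (-1 / w) =
      thetaFactor w * (w ^ 4 * deriv (deriv h) w + 3 * w ^ 3 * deriv h w +
        3 / 4 * w ^ 2 * h w) := by
    intro w hw
    rw [deriv_neg_one_div g1 (by fun_prop) H1 hw]
    have e := ((((hasDerivAt_id w).fun_pow 2).mul (hd h1 w hw)).add
      (((hasDerivAt_id w).div_const 2).mul (hd hh w hw))).deriv
    have e' : deriv (fun w ↦ w ^ 2 * deriv h w + w / 2 * h w) w = _ := e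
    rw [e']
    simp only [id, Nat.cast_ofNat]
    ring
  have H3 : deriv (deriv (deriv g)) (-1 / z) =
      thetaFactor z * (z ^ 6 * deriv (deriv (deriv h)) z + 15 / 2 * z ^ 5 * deriv (deriv h) z +
        45 / 4 * z ^ 4 * deriv h z + 15 / 8 * z ^ 3 * h z) := by
    rw [deriv_neg_one_div g2 (by fun_prop) H2 hz]
    have e := (((((hasDerivAt_id z).fun_pow 4).mul (hd h2 z hz)).add
      ((((hasDerivAt_id z).fun_pow 3).const_mul 3).mul (hd h1 z hz))).add
      ((((hasDerivAt_id z).fun_pow 2).const_mul (3 / 4)).mul (hd hh z hz))).deriv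
    have e' : deriv (fun z ↦ z ^ 4 * deriv (deriv h) z + 3 * z ^ 3 * deriv h z +
        3 / 4 * z ^ 2 * h z) z = _ := e
    rw [e']
    simp only [id, Nat.cast_ofNat]
    ring
  rw [bracket, bracket, H z hz, H1 z hz, H2 z hz, H3]
  have h4 := @thetaFactor_pow_four z
  linear_combination (z ^ 6 * (h z ^ 3 * deriv (deriv (deriv h)) z - 15 * h z ^ 2 * deriv h z *
    deriv (deriv h) z + 30 * h z * deriv h z ^ 3)) * h4

/-- Cauchy's estimate on discs of radius 1, applied to `g - c`. -/
lemma tendsto_deriv_comap_im {g : ℂ → ℂ} (hg : DifferentiableOn ℂ g {z : ℂ | 0 < z.im}) {c : ℂ}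
    (hc : Tendsto g (comap Complex.im atTop) (𝓝 c)) :
    Tendsto (deriv g) (comap Complex.im atTop) (𝓝 0) := by
  rw [Metric.tendsto_nhds] at hc ⊢
  intro ε hε
  obtain ⟨A, hA⟩ := eventually_atTop.1 (eventually_comap.1 (hc (ε / 2) (by positivity)))
  -- Above this height the closed unit disc around `z` stays in the half-plane and in the region
  -- where `g` is within ε/2 of `c`.
  refine eventually_comap.2 (eventually_atTop.2 ⟨max A 1 + 1, ?_⟩)
  rintro _ hz z rfl
  have him : ∀ w ∈ Metric.closedBall z 1, max A 1 ≤ w.im := by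
    intro w hw
    have h1 := (Complex.abs_im_le_norm (w - z)).trans (mem_closedBall_iff_norm.1 hw)
    rw [Complex.sub_im, abs_le] at h1
    linarith [h1.1]
  have hpos : ∀ w ∈ Metric.closedBall z 1, 0 < w.im := fun w hw ↦
    one_pos.trans_le ((le_max_right _ _).trans (him w hw))
  have hd : DiffContOnCl ℂ (fun w ↦ g w - c) (Metric.ball z 1) := by
    apply DifferentiableOn.diffContOnCl
    rw [closure_ball _ one_ne_zero]
    exact (hg.mono fun w hw ↦ hpos w hw).sub_const c
  have h := Complex.norm_deriv_le_of_forall_mem_sphere_norm_le one_pos hd (C := ε / 2)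
    (fun w hw ↦ by
      have := hA w.im ((le_max_left _ _).trans (him w (Metric.sphere_subset_closedBall hw))) w rfl
      rw [dist_eq_norm] at this
      exact this.le)
  rw [deriv_sub_const] at h
  rw [dist_zero_right]
  linarith

/-- Every term contains a derivative of `g`. This is what makes the theta series vanish at the
cusps, even though θ itself tends to 1. -/
lemma tendsto_bracket_comap_im {g : ℂ → ℂ} (hg : DifferentiableOn ℂ g {z : ℂ | 0 < z.im}) {c : ℂ}
    (hc : Tendsto g (comap Complex.im atTop) (𝓝 c)) :
    Tendsto (bracket g) (comap Complex.im atTop) (𝓝 0) := by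
  have g1 := differentiableOn_deriv_im_pos hg
  have g2 := differentiableOn_deriv_im_pos g1
  have t1 := tendsto_deriv_comap_im hg hc
  have t2 := tendsto_deriv_comap_im g1 t1
  have t3 := tendsto_deriv_comap_im g2 t2
  have := (((hc.pow 3).mul t3).sub ((((hc.pow 2).const_mul 15).mul t1).mul t2)).add
    ((hc.const_mul 30).mul (t1.pow 3))
  rw [show c ^ 3 * 0 - 15 * c ^ 2 * 0 * 0 + 30 * c * 0 ^ 3 = 0 by ring] at this
  exact this

end LatticeDesign

end

/-! ### The theta series of D₄ as a cusp form -/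

section

open UpperHalfPlane ModularGroup Filter Asymptotics
open scoped Topology ModularForm

namespace LatticeDesign

lemma hasSum_jacobiTheta {z : ℂ} (hz : 0 < z.im) :
    HasSum (fun n : ℤ ↦ Complex.exp (Real.pi * Complex.I * (n : ℂ) ^ 2 * z)) (jacobiTheta z) := by
  have h := hasSum_jacobiTheta₂_term 0 hz
  rw [jacobiTheta_eq_jacobiTheta₂]
  simpa [jacobiTheta₂_term] using h

lemma hasSum_jacobiTheta_even {z : ℂ} (hz : 0 < z.im) :
    HasSum (fun n : ℤ ↦ if Even n then Complex.exp (Real.pi * Complex.I * (n : ℂ) ^ 2 * z) else 0)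
      (jacobiTheta (4 * z)) := by
  have h := hasSum_jacobiTheta (z := 4 * z) (by simpa using hz)
  have hinj : Function.Injective (fun n : ℤ ↦ 2 * n) := fun a b hab ↦ by
    simpa using hab
  rw [← hinj.hasSum_iff]
  · convert! h using 2 with n
    simp only [Function.comp, even_two_mul, if_true]
    congr 1
    push_cast; ring
  · intro n hn
    rw [if_neg]
    rintro ⟨m, rfl⟩
    exact hn ⟨m, by ring⟩

lemma exp_pi_mul_int_sq (n : ℤ) :
    Complex.exp (Real.pi * Complex.I * (n : ℂ) ^ 2) = if Even n then 1 else -1 := by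
  split_ifs with h
  · obtain ⟨m, rfl⟩ := h
    rw [← Complex.exp_int_mul_two_pi_mul_I (2 * m ^ 2)]
    congr 1
    push_cast; ring
  · obtain ⟨m, rfl⟩ := Int.not_even_iff_odd.1 h
    rw [← Complex.exp_pi_mul_I, ← one_mul (Complex.exp (Real.pi * Complex.I)),
      ← Complex.exp_int_mul_two_pi_mul_I (2 * m ^ 2 + 2 * m), ← Complex.exp_add]
    congr 1
    push_cast; ring

lemma exp_pi_div_two_mul_int_sq (n : ℤ) :
    Complex.exp (Real.pi * Complex.I * (n : ℂ) ^ 2 * (1 / 2)) =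
      if Even n then 1 else Complex.I := by
  split_ifs with h
  · obtain ⟨m, rfl⟩ := h
    refine Eq.trans ?_ (Complex.exp_int_mul_two_pi_mul_I (m ^ 2))
    congr 1
    push_cast; ring
  · obtain ⟨m, rfl⟩ := Int.not_even_iff_odd.1 h
    rw [show (Real.pi * Complex.I * ((2 * m + 1 : ℤ) : ℂ) ^ 2 * (1 / 2)) =
      ((2 * (m ^ 2 + m) : ℤ) : ℂ) * (Real.pi * Complex.I) + Real.pi / 2 * Complex.I by
        push_cast; ring, Complex.exp_add, Complex.exp_pi_div_two_mul_I]
    have := Complex.exp_int_mul_two_pi_mul_I (m ^ 2 + m)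
    rw [show ((2 * (m ^ 2 + m) : ℤ) : ℂ) * (Real.pi * Complex.I) =
      ((m ^ 2 + m : ℤ) : ℂ) * (2 * Real.pi * Complex.I) by push_cast; ring, this, one_mul]

/-- The shift introduces the sign (-1)ⁿ, and the terms with even n sum to θ(4z). -/
lemma jacobiTheta_add_one {z : ℂ} (hz : 0 < z.im) :
    jacobiTheta (z + 1) = 2 * jacobiTheta (4 * z) - jacobiTheta z := by
  have h1 := hasSum_jacobiTheta (z := z + 1) (by simpa using hz)
  have h2 := ((hasSum_jacobiTheta_even hz).mul_left 2).sub (hasSum_jacobiTheta hz)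
  refine h1.unique ?_
  convert! h2 using 2 with n
  rw [mul_add, Complex.exp_add, mul_one, exp_pi_mul_int_sq]
  split_ifs <;> ring

lemma jacobiTheta_add_half {z : ℂ} (hz : 0 < z.im) :
    jacobiTheta (z + 1 / 2) =
      (1 - Complex.I) * jacobiTheta (4 * z) + Complex.I * jacobiTheta z := by
  have h1 := hasSum_jacobiTheta (z := z + 1 / 2) (by simpa using hz)
  have h2 := ((hasSum_jacobiTheta_even hz).mul_left (1 - Complex.I)).add
    ((hasSum_jacobiTheta hz).mul_left Complex.I)
  refine h1.unique ?_
  convert! h2 using 2 with n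
  rw [mul_add, Complex.exp_add, exp_pi_div_two_mul_int_sq]
  split_ifs <;> ring

lemma jacobiTheta_neg_one_div {z : ℂ} (hz : 0 < z.im) :
    jacobiTheta (-1 / z) = thetaFactor z * jacobiTheta z := by
  have := jacobiTheta_S_smul ⟨z, hz⟩
  rwa [coe_S_smul] at this

/-- Jacobi's theta function `θ₂`, the sum of `exp(πi(n + 1/2)²z)`. -/
noncomputable def thetaTwo (z : ℂ) : ℂ := jacobiTheta (z / 4) - jacobiTheta z

lemma div_four_im_pos {z : ℂ} (hz : 0 < z.im) : 0 < (z / 4).im := by simpa using hz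

lemma jacobiTheta_neg_one_div_add_one {z : ℂ} (hz : 0 < z.im) :
    jacobiTheta (-1 / z + 1) = thetaFactor z * thetaTwo z := by
  have h4 : thetaFactor z = 2 * thetaFactor (z / 4) := by
    have := thetaFactor_ofReal_mul two_pos (div_four_im_pos hz)
    rw [← Complex.ofReal_ofNat, ← this]
    congr 1
    push_cast; ring
  have h0 := ne_zero_of_im_pos hz
  rw [jacobiTheta_add_one (neg_one_div_im_pos hz),
    show 4 * (-1 / z) = -1 / (z / 4) by field_simp, jacobiTheta_neg_one_div hz,
    jacobiTheta_neg_one_div (div_four_im_pos hz), thetaTwo]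
  linear_combination - jacobiTheta (z / 4) * h4

/-- The exponents of θ₂ are odd squares over 4, and odd squares are 1 modulo 8. The factor I
disappears in the bracket, which is homogeneous of degree 4. -/
lemma thetaTwo_add_two {z : ℂ} (hz : 0 < z.im) :
    thetaTwo (z + 2) = Complex.I * thetaTwo z := by
  rw [thetaTwo, thetaTwo, show (z + 2) / 4 = z / 4 + 1 / 2 by ring,
    jacobiTheta_add_half (div_four_im_pos hz), add_comm z 2, jacobiTheta_two_add,
    show 4 * (z / 4) = z by ring]
  ring

lemma differentiableOn_jacobiTheta : DifferentiableOn ℂ jacobiTheta {z : ℂ | 0 < z.im} :=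
  fun _ hz ↦ (differentiableAt_jacobiTheta hz).differentiableWithinAt

lemma differentiableOn_thetaTwo : DifferentiableOn ℂ thetaTwo {z : ℂ | 0 < z.im} :=
  (differentiableOn_jacobiTheta.comp (by fun_prop) fun _ hz ↦ div_four_im_pos hz).sub
    differentiableOn_jacobiTheta

lemma differentiableOn_jacobiTheta_add_one :
    DifferentiableOn ℂ (fun z ↦ jacobiTheta (z + 1)) {z : ℂ | 0 < z.im} :=
  differentiableOn_jacobiTheta.comp (by fun_prop) fun _ hz ↦ by simpa using hz

lemma tendsto_jacobiTheta : Tendsto jacobiTheta (comap Complex.im atTop) (𝓝 1) := by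
  have h : Tendsto (fun z : ℂ ↦ Real.exp (-Real.pi * z.im)) (comap Complex.im atTop) (𝓝 0) := by
    refine Real.tendsto_exp_atBot.comp ?_
    exact tendsto_comap.const_mul_atTop_of_neg (by simpa using Real.pi_pos)
  have := (isBigO_at_im_infty_jacobiTheta_sub_one.trans_tendsto h).add_const 1
  simpa using this

lemma tendsto_thetaTwo : Tendsto thetaTwo (comap Complex.im atTop) (𝓝 0) := by
  have h : Tendsto (fun z : ℂ ↦ z / 4) (comap Complex.im atTop) (comap Complex.im atTop) := by
    rw [tendsto_comap_iff]
    have : Tendsto (fun z : ℂ ↦ z.im / 4) (comap Complex.im atTop) atTop :=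
      tendsto_comap.atTop_div_const (by norm_num)
    refine this.congr fun z ↦ ?_
    simp
  have := (tendsto_jacobiTheta.comp h).sub tendsto_jacobiTheta
  rwa [sub_self] at this

lemma bracket_jacobiTheta_add_two (z : ℂ) : bracket jacobiTheta (z + 2) = bracket jacobiTheta z := by
  rw [← bracket_comp_add_const]
  congr 1
  ext w
  rw [add_comm, jacobiTheta_two_add]

lemma bracket_jacobiTheta_neg_one_div {z : ℂ} (hz : 0 < z.im) :
    bracket jacobiTheta (-1 / z) = -(z ^ 8 * bracket jacobiTheta z) :=
  bracket_neg_one_div differentiableOn_jacobiTheta differentiableOn_jacobiTheta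
    (fun _ h ↦ jacobiTheta_neg_one_div h) hz

lemma bracket_jacobiTheta_neg_one_div_add_one {z : ℂ} (hz : 0 < z.im) :
    bracket jacobiTheta (-1 / z + 1) = -(z ^ 8 * bracket thetaTwo z) := by
  rw [← bracket_comp_add_const]
  exact bracket_neg_one_div differentiableOn_jacobiTheta_add_one differentiableOn_thetaTwo
    (fun _ h ↦ jacobiTheta_neg_one_div_add_one h) hz

lemma bracket_thetaTwo_add_two {z : ℂ} (hz : 0 < z.im) :
    bracket thetaTwo (z + 2) = bracket thetaTwo z := by
  rw [← bracket_comp_add_const, bracket_congr (h := fun z ↦ Complex.I * thetaTwo z)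
    (fun w hw ↦ thetaTwo_add_two hw) hz, bracket_const_mul]
  simp

/-- Up to a constant, the theta series of `D₄` with a harmonic coefficient of degree `6`. -/
noncomputable def thetaD4 (z : ℍ) : ℂ :=
  bracket jacobiTheta z + bracket jacobiTheta (z + 1)

lemma thetaD4_slash_T : thetaD4 ∣[(8 : ℤ)] T = thetaD4 := by
  ext z
  rw [slash_T_apply]
  simp only [thetaD4, coe_vadd, Complex.ofReal_one]
  rw [show (1 : ℂ) + z + 1 = z + 2 by ring, bracket_jacobiTheta_add_two, add_comm (1 : ℂ), add_comm]

lemma thetaD4_slash_S :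
    thetaD4 ∣[(8 : ℤ)] S = fun z : ℍ ↦ -(bracket jacobiTheta z + bracket thetaTwo z) := by
  ext z
  rw [slash_S_apply]
  simp only [thetaD4, coe_S_smul]
  rw [bracket_jacobiTheta_neg_one_div z.im_pos, bracket_jacobiTheta_neg_one_div_add_one z.im_pos,
    zpow_neg]
  have := z.ne_zero
  norm_cast
  field_simp
  ring

lemma thetaD4_slash_S_T_T :
    ((thetaD4 ∣[(8 : ℤ)] S) ∣[(8 : ℤ)] T) ∣[(8 : ℤ)] T = thetaD4 ∣[(8 : ℤ)] S := by
  ext z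
  rw [slash_T_apply, slash_T_apply, thetaD4_slash_S]
  simp only [coe_vadd, Complex.ofReal_one]
  rw [show (1 : ℂ) + (1 + z) = z + 2 by ring, bracket_jacobiTheta_add_two,
    bracket_thetaTwo_add_two z.im_pos]

lemma tendsto_bracket_atImInfty {g : ℂ → ℂ} (hg : DifferentiableOn ℂ g {z : ℂ | 0 < z.im}) {c : ℂ}
    (hc : Tendsto g (comap Complex.im atTop) (𝓝 c)) :
    Tendsto (fun z : ℍ ↦ bracket g z) atImInfty (𝓝 0) :=
  (tendsto_bracket_comap_im hg hc).comp tendsto_coe_atImInfty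

lemma isZeroAtImInfty_thetaD4 : IsZeroAtImInfty thetaD4 := by
  have h := tendsto_bracket_atImInfty differentiableOn_jacobiTheta tendsto_jacobiTheta
  have hT : Tendsto (fun z : ℍ ↦ (1 : ℝ) +ᵥ z) atImInfty atImInfty := by
    rw [atImInfty, tendsto_comap_iff]
    exact tendsto_comap.congr fun z ↦ by simp
  have h' := h.add (h.comp hT)
  rw [add_zero] at h'
  refine h'.congr fun z ↦ ?_
  simp [thetaD4, add_comm]

lemma isZeroAtImInfty_thetaD4_slash_S : IsZeroAtImInfty (thetaD4 ∣[(8 : ℤ)] S) := by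
  rw [thetaD4_slash_S]
  simpa [IsZeroAtImInfty, ZeroAtFilter] using
    ((tendsto_bracket_atImInfty differentiableOn_jacobiTheta tendsto_jacobiTheta).add
      (tendsto_bracket_atImInfty differentiableOn_thetaTwo tendsto_thetaTwo)).neg

open scoped Manifold in
lemma mdifferentiable_thetaD4 : MDiff thetaD4 := by
  rw [UpperHalfPlane.mdifferentiable_iff]
  have h := differentiableOn_bracket differentiableOn_jacobiTheta
  refine .congr (f := fun z ↦ bracket jacobiTheta z + bracket jacobiTheta (z + 1))
    (h.add (h.comp (by fun_prop) fun _ hz ↦ by simpa using hz)) fun z hz ↦ ?_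
  have hz' : 0 < z.im := hz
  simp [thetaD4, ofComplex_apply_of_im_pos hz']

/-- The theta series of `D₄` as a cusp form of weight `8` on `Γ₁(2)`. -/
noncomputable def thetaD4CuspForm : CuspFormGamma1 2 8 :=
  cuspFormOfGenerators even_eight thetaD4 mdifferentiable_thetaD4 thetaD4_slash_T
    thetaD4_slash_S_T_T isZeroAtImInfty_thetaD4 isZeroAtImInfty_thetaD4_slash_S

@[simp] lemma coe_thetaD4CuspForm : ⇑thetaD4CuspForm = thetaD4 := rfl

end LatticeDesign

end

/-! ### Fourier coefficients of the theta series as sums over shells -/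

section

open UpperHalfPlane Filter
open scoped Topology

namespace LatticeDesign

/-- The terms of the `k`-th derivative of Jacobi's theta function, up to a factor `(πi)ᵏ`. -/
noncomputable def thetaTerm (k : ℕ) (n : ℤ) (z : ℂ) : ℂ :=
  ((n : ℂ) ^ 2) ^ k * Complex.exp (Real.pi * Complex.I * (n : ℂ) ^ 2 * z)

/-- The series `∑ n²ᵏ exp(πin²z)`. -/
noncomputable def thetaMoment (k : ℕ) (z : ℂ) : ℂ := ∑' n : ℤ, thetaTerm k n z

lemma norm_thetaTerm (k : ℕ) (n : ℤ) (z : ℂ) :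
    ‖thetaTerm k n z‖ = |(n : ℝ)| ^ (2 * k) * Real.exp (-Real.pi * (z.im * n ^ 2)) := by
  rw [thetaTerm, norm_mul, Complex.norm_exp]
  congr 1
  · rw [norm_pow, norm_pow, Complex.norm_intCast, pow_mul]
  · congr 1
    have : (Real.pi * Complex.I * (n : ℂ) ^ 2 * z) =
        ((Real.pi * n ^ 2 : ℝ) : ℂ) * (Complex.I * z) := by push_cast; ring
    rw [this, Complex.re_ofReal_mul]
    simp
    ring

lemma summable_thetaTerm_bound (k : ℕ) {ε : ℝ} (hε : 0 < ε) :
    Summable fun n : ℤ ↦ |(n : ℝ)| ^ (2 * k) * Real.exp (-Real.pi * (ε * n ^ 2)) := by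
  simpa using summable_pow_mul_jacobiTheta₂_term_bound 0 hε (2 * k)

lemma summable_norm_thetaTerm (k : ℕ) {z : ℂ} (hz : 0 < z.im) :
    Summable fun n : ℤ ↦ ‖thetaTerm k n z‖ := by
  simpa only [norm_thetaTerm] using summable_thetaTerm_bound k hz

lemma hasDerivAt_thetaTerm (k : ℕ) (n : ℤ) (z : ℂ) :
    HasDerivAt (thetaTerm k n) (Real.pi * Complex.I * thetaTerm (k + 1) n z) z := by
  have h1 : HasDerivAt (fun z : ℂ ↦ Real.pi * Complex.I * (n : ℂ) ^ 2 * z)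
      (Real.pi * Complex.I * (n : ℂ) ^ 2) z := by
    simpa using (hasDerivAt_id z).const_mul (Real.pi * Complex.I * (n : ℂ) ^ 2)
  have h := h1.cexp.const_mul (((n : ℂ) ^ 2) ^ k)
  refine h.congr_deriv ?_
  rw [thetaTerm]
  ring

lemma deriv_thetaMoment (k : ℕ) {z : ℂ} (hz : 0 < z.im) :
    deriv (thetaMoment k) z = Real.pi * Complex.I * thetaMoment (k + 1) z := by
  -- Termwise differentiation needs one summable bound near `z`; on this half-plane the terms at
  -- height `z.im / 2` provide it.
  have hU : IsOpen {w : ℂ | z.im / 2 < w.im} := isOpen_lt continuous_const Complex.continuous_im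
  have h := Complex.hasSum_deriv_of_summable_norm (F := thetaTerm k)
    (summable_thetaTerm_bound k (half_pos hz))
    (fun n w _ ↦ (hasDerivAt_thetaTerm k n w).differentiableAt.differentiableWithinAt) hU
    (fun n w hw ↦ by
      rw [norm_thetaTerm]
      have hw' : z.im / 2 < w.im := hw
      have := Real.pi_pos
      gcongr _ * Real.exp ?_
      have h2 : z.im / 2 * (n : ℝ) ^ 2 ≤ w.im * (n : ℝ) ^ 2 := by gcongr
      nlinarith) (z := z) (half_lt_self hz)
  have h2 : HasSum (fun n ↦ deriv (thetaTerm k n) z)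
      (Real.pi * Complex.I * thetaMoment (k + 1) z) := by
    simp only [(hasDerivAt_thetaTerm k _ z).deriv]
    exact (summable_norm_thetaTerm (k + 1) hz).of_norm.hasSum.mul_left _
  exact h.unique h2

lemma jacobiTheta_eq_thetaMoment : jacobiTheta = thetaMoment 0 := by
  ext z
  simp [jacobiTheta, thetaMoment, thetaTerm]

lemma deriv_eq_const_mul {f g h : ℂ → ℂ} {a b : ℂ} (hf : ∀ z : ℂ, 0 < z.im → f z = a * g z)
    (hg : ∀ z : ℂ, 0 < z.im → deriv g z = b * h z) {z : ℂ} (hz : 0 < z.im) :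
    deriv f z = a * b * h z := by
  have : f =ᶠ[𝓝 z] fun w ↦ a * g w :=
    Set.EqOn.eventuallyEq_of_mem (s := {z : ℂ | 0 < z.im}) hf (isOpen_im_pos.mem_nhds hz)
  rw [this.deriv_eq, deriv_const_mul_field, hg z hz, mul_assoc]

lemma bracket_jacobiTheta {z : ℂ} (hz : 0 < z.im) :
    bracket jacobiTheta z = (Real.pi * Complex.I) ^ 3 *
      (thetaMoment 0 z ^ 3 * thetaMoment 3 z -
        15 * (thetaMoment 0 z ^ 2 * thetaMoment 1 z * thetaMoment 2 z) +
        30 * (thetaMoment 0 z * thetaMoment 1 z ^ 3)) := by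
  have h1 : ∀ z : ℂ, 0 < z.im → deriv jacobiTheta z = Real.pi * Complex.I * thetaMoment 1 z := by
    intro z hz
    rw [jacobiTheta_eq_thetaMoment, deriv_thetaMoment 0 hz]
  have h2 : ∀ z : ℂ, 0 < z.im → deriv (deriv jacobiTheta) z = _ := fun z hz ↦
    deriv_eq_const_mul h1 (fun z hz ↦ deriv_thetaMoment 1 hz) hz
  have h3 : deriv (deriv (deriv jacobiTheta)) z = _ :=
    deriv_eq_const_mul h2 (fun z hz ↦ deriv_thetaMoment 2 hz) hz
  rw [bracket, h1 z hz, h2 z hz, h3, jacobiTheta_eq_thetaMoment]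
  ring

lemma hasSum_mul_of_summable_norm {ι κ : Type*} {u : ι → ℂ} {v : κ → ℂ} {a b : ℂ}
    (hu : Summable fun x ↦ ‖u x‖) (hv : Summable fun x ↦ ‖v x‖) (ha : HasSum u a)
    (hb : HasSum v b) : (Summable fun x : ι × κ ↦ ‖u x.1 * v x.2‖) ∧
      HasSum (fun x : ι × κ ↦ u x.1 * v x.2) (a * b) :=
  ⟨hu.mul_norm hv, ha.mul hb (summable_mul_of_summable_norm hu hv)⟩

theorem hasSum_prod_fin {ι : Type*} {n : ℕ} (f : Fin n → ι → ℂ)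
    (hf : ∀ i, Summable fun x ↦ ‖f i x‖) :
    (Summable fun x : Fin n → ι ↦ ‖∏ i, f i (x i)‖) ∧
      HasSum (fun x : Fin n → ι ↦ ∏ i, f i (x i)) (∏ i, ∑' x, f i x) := by
  induction n with
  | zero =>
    refine ⟨.of_finite, ?_⟩
    convert! hasSum_fintype (fun x : Fin 0 → ι ↦ ∏ i, f i (x i)) using 1
    simp
  | succ n ih =>
    obtain ⟨ih1, ih2⟩ := ih (fun i ↦ f i.succ) (fun i ↦ hf i.succ)
    obtain ⟨hs, h⟩ := hasSum_mul_of_summable_norm (hf 0) ih1 (hf 0).of_norm.hasSum ih2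
    refine ⟨?_, ?_⟩
    · rw [← (Fin.consEquiv fun _ ↦ ι).summable_iff]
      simpa [Function.comp_def, Fin.consEquiv, Fin.prod_univ_succ] using hs
    · rw [← (Fin.consEquiv fun _ ↦ ι).hasSum_iff, Fin.prod_univ_succ]
      simpa [Function.comp_def, Fin.consEquiv, Fin.prod_univ_succ] using h

/-- A representative, modulo the symmetries of `D₄`, of the harmonic polynomials of degree `6`. -/
def sexticForm (x : Fin 4 → ℤ) : ℤ :=
  x 0 ^ 6 - 15 * (x 0 ^ 4 * x 1 ^ 2) + 30 * (x 0 ^ 2 * x 1 ^ 2 * x 2 ^ 2)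

lemma hasSum_sexticForm {z : ℂ} (hz : 0 < z.im) :
    HasSum (fun x : Fin 4 → ℤ ↦ (Real.pi * Complex.I) ^ 3 * ((sexticForm x : ℂ) *
      Complex.exp (Real.pi * Complex.I * ((∑ i, x i ^ 2 : ℤ) : ℂ) * z)))
      (bracket jacobiTheta z) := by
  have H : ∀ a : Fin 4 → ℕ, HasSum (fun x : Fin 4 → ℤ ↦ ∏ i, thetaTerm (a i) (x i) z)
      (∏ i, thetaMoment (a i) z) := fun a ↦
    (hasSum_prod_fin (fun i n ↦ thetaTerm (a i) n z) fun i ↦ summable_norm_thetaTerm (a i) hz).2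
  rw [bracket_jacobiTheta hz]
  refine HasSum.mul_left _ ?_
  -- A factor θ differentiated k times carries the weight n²ᵏ, so the three monomials of the bracket
  -- become the three monomials of `sexticForm`.
  convert! ((H ![3, 0, 0, 0]).sub ((H ![2, 1, 0, 0]).mul_left 15)).add
    ((H ![1, 1, 1, 0]).mul_left 30) using 1
  · ext x
    have : Complex.exp (Real.pi * Complex.I * ((∑ i, x i ^ 2 : ℤ) : ℂ) * z) =
        ∏ i, Complex.exp (Real.pi * Complex.I * (x i : ℂ) ^ 2 * z) := by
      rw [← Complex.exp_sum]
      congr 1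
      push_cast
      rw [Finset.mul_sum, Finset.sum_mul]
    rw [this]
    simp [Fin.prod_univ_four, thetaTerm, sexticForm]
    ring
  · simp [Fin.prod_univ_four]
    ring

lemma exp_pi_mul_int (n : ℤ) :
    Complex.exp (Real.pi * Complex.I * (n : ℂ)) = if Even n then 1 else -1 := by
  rw [mul_comm, Complex.exp_int_mul, Complex.exp_pi_mul_I]
  split_ifs with h
  · exact h.neg_one_zpow
  · exact (Int.not_even_iff_odd.1 h).neg_one_zpow

/-- The integral points of norm `2m`. -/
noncomputable def shellPoints (m : ℕ) : Finset (Fin 4 → ℤ) :=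
  (Fintype.piFinset fun _ ↦ Finset.Icc (-(2 * m : ℤ)) (2 * m)).filter
    fun x ↦ ∑ i, x i ^ 2 = 2 * m

@[simp] lemma mem_shellPoints {m : ℕ} {x : Fin 4 → ℤ} :
    x ∈ shellPoints m ↔ ∑ i, x i ^ 2 = 2 * m := by
  refine ⟨fun h ↦ (Finset.mem_filter.1 h).2, fun h ↦ Finset.mem_filter.2 ⟨?_, h⟩⟩
  rw [Fintype.mem_piFinset]
  intro i
  have h1 : x i ^ 2 ≤ 2 * m :=
    h ▸ Finset.single_le_sum (fun j _ ↦ sq_nonneg (x j)) (Finset.mem_univ i)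
  rw [Finset.mem_Icc]
  constructor <;> nlinarith

/-- Replacing z by z + 1 multiplies the term of x by the sign of the parity of |x|²: even norms
double and odd norms cancel. -/
lemma hasSum_thetaD4_points (z : ℍ) :
    HasSum (fun x : Fin 4 → ℤ ↦ 2 * (Real.pi * Complex.I) ^ 3 *
      (if Even (∑ i, x i ^ 2) then (sexticForm x : ℂ) *
        Complex.exp (Real.pi * Complex.I * ((∑ i, x i ^ 2 : ℤ) : ℂ) * z) else 0)) (thetaD4 z) := by
  convert! (hasSum_sexticForm z.im_pos).add (hasSum_sexticForm (z := z + 1) (by simpa using z.im_pos))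
    using 2 with x
  rw [mul_add _ (z : ℂ), Complex.exp_add, mul_one, exp_pi_mul_int]
  split_ifs <;> ring

/-- Regrouping along `g`, where `s k` need only contain the points of the fibre at which `f` is
nonzero. -/
theorem hasSum_sum_fiber {ι κ : Type*} {f : ι → ℂ} {a : ℂ} (h : HasSum f a) (g : ι → κ)
    (s : κ → Finset ι) (hs : ∀ k, ∀ x ∈ s k, g x = k) (h0 : ∀ x, x ∉ s (g x) → f x = 0) :
    HasSum (fun k ↦ ∑ x ∈ s k, f x) a := by
  refine ((Equiv.sigmaFiberEquiv g).hasSum_iff.mpr h).sigma fun k ↦ ?_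
  have key : HasSum (Set.indicator {x | g x = k} f) (∑ x ∈ s k, f x) := by
    rw [← Finset.sum_congr rfl fun x hx ↦ Set.indicator_of_mem (s := {x | g x = k}) (hs k x hx) f]
    refine hasSum_sum_of_ne_finset_zero fun x hx ↦ ?_
    by_cases hk : g x = k
    · subst hk
      rw [Set.indicator_of_mem (show x ∈ {y | g y = g x} from rfl), h0 x hx]
    · exact Set.indicator_of_notMem (show x ∉ {y | g y = k} from hk) f
  exact hasSum_subtype_iff_indicator.2 key

lemma mem_shellPoints_half {x : Fin 4 → ℤ} (hx : Even (∑ i, x i ^ 2)) :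
    x ∈ shellPoints ((∑ i, x i ^ 2).toNat / 2) := by
  have : 0 ≤ ∑ i, x i ^ 2 := Finset.sum_nonneg fun i _ ↦ sq_nonneg _
  rw [mem_shellPoints]
  generalize ∑ i, x i ^ 2 = n at *
  obtain ⟨k, rfl⟩ := hx
  omega

lemma hasSum_thetaD4 (z : ℍ) :
    HasSum (fun m : ℕ ↦ (2 * (Real.pi * Complex.I) ^ 3 * ∑ x ∈ shellPoints m, (sexticForm x : ℂ)) *
      Function.Periodic.qParam 1 z ^ m) (thetaD4 z) := by
  -- Halving puts norms 2m and 2m + 1 in the same fibre; the latter have zero terms.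
  convert! hasSum_sum_fiber (hasSum_thetaD4_points z) (fun x ↦ (∑ i, x i ^ 2).toNat / 2)
    shellPoints ?_ ?_ using 1
  · ext m
    rw [mul_assoc, Finset.sum_mul, Finset.mul_sum]
    refine Finset.sum_congr rfl fun x hx ↦ ?_
    have hx' := mem_shellPoints.1 hx
    rw [hx', if_pos (even_two_mul _), Function.Periodic.qParam, ← Complex.exp_nat_mul]
    congr 3
    push_cast
    ring
  · intro m x hx
    rw [mem_shellPoints.1 hx]
    omega
  · intro x hx
    rw [if_neg fun h ↦ hx (mem_shellPoints_half h), mul_zero]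

lemma sum_shellPoints_one : ∑ x ∈ shellPoints 1, sexticForm x = -48 := by
  decide +kernel

/-- Both sides come from the same line of cusp forms, so the coefficient of q fixes the ratio. -/
theorem tau2_eq_sum (m : ℕ) : ∑ x ∈ shellPoints m, (sexticForm x : ℂ) = -48 * tau2 m := by
  have hc := fun m ↦ ModularFormClass.qExpansion_coeff_unique one_pos
    (one_mem_strictPeriods_Gamma1 2) (f := thetaD4CuspForm)
    (fun z ↦ by simpa only [smul_eq_mul, coe_thetaD4CuspForm] using hasSum_thetaD4 z) m
  have h := thetaD4CuspForm.eq_coeff_smul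
  have hm : (qExpansion 1 thetaD4CuspForm).coeff m =
      (qExpansion 1 thetaD4CuspForm).coeff 1 * tau2 m := by
    conv_lhs => rw [h]
    rw [FunLike.coe_smul, ModularForm.qExpansion_smul one_pos (one_mem_strictPeriods_Gamma1 2),
      PowerSeries.coeff_smul, smul_eq_mul, coe_etaCuspForm, tau2]
  rw [← hc, ← hc] at hm
  have h1 := congrArg (Int.cast : ℤ → ℂ) sum_shellPoints_one
  push_cast at h1
  rw [h1] at hm
  have hne : (2 * (Real.pi * Complex.I) ^ 3 : ℂ) ≠ 0 := by
    simp [Real.pi_ne_zero, Complex.I_ne_zero]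
  exact mul_left_cancel₀ hne (hm.trans (mul_assoc _ _ _))

theorem tau2_eq_zero_iff (m : ℕ) : tau2 m = 0 ↔ ∑ x ∈ shellPoints m, sexticForm x = 0 := by
  rw [← Int.cast_inj (α := ℂ)]
  push_cast
  rw [tau2_eq_sum]
  simp

end LatticeDesign

end

/-! ### Harmonic sextics summed over a shell -/

section

open MvPolynomial

namespace LatticeDesign

/-- The exponent vector of `x₀ᵃ x₁ᵇ x₂ᶜ x₃ᵈ`. -/
noncomputable def expVec (d : Fin 4 → ℕ) : Fin 4 →₀ ℕ := Finsupp.equivFunOnFinite.symm d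

@[simp] lemma expVec_apply (d : Fin 4 → ℕ) (i : Fin 4) : expVec d i = d i := rfl

lemma expVec_injective : Function.Injective expVec := Finsupp.equivFunOnFinite.symm.injective

lemma expVec_coe (d : Fin 4 →₀ ℕ) : expVec d = d := Finsupp.equivFunOnFinite.symm_apply_apply d

lemma eval_eq_sum_antidiagonalTuple {P : MvPolynomial (Fin 4) ℝ} {n : ℕ} (hP : P.IsHomogeneous n)
    (x : Fin 4 → ℝ) : eval x P =
      ∑ d ∈ Finset.Nat.antidiagonalTuple 4 n, coeff (expVec d) P * ∏ i, x i ^ d i := by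
  rw [eval_eq']
  have hinj : Set.InjOn expVec (Finset.Nat.antidiagonalTuple 4 n) := expVec_injective.injOn
  refine Eq.trans ?_ (Finset.sum_image (f := fun d : Fin 4 →₀ ℕ ↦ coeff d P * ∏ i, x i ^ d i) hinj)
  refine Finset.sum_subset (fun d hd ↦ ?_) fun d _ hd ↦ ?_
  · rw [Finset.mem_image]
    refine ⟨d, ?_, expVec_coe d⟩
    rw [Finset.Nat.mem_antidiagonalTuple]
    have := hP (mem_support_iff.1 hd)
    rw [Finsupp.weight_apply, Finsupp.sum_fintype _ _ (by simp)] at this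
    simpa using this
  · rw [notMem_support_iff.1 hd, zero_mul]

/-- The moments of a finite set of integral points. -/
noncomputable def moment (s : Finset (Fin 4 → ℤ)) (d : Fin 4 → ℕ) : ℝ :=
  ∑ x ∈ s, ∏ i, (x i : ℝ) ^ d i

lemma moment_comp_perm {m : ℕ} (d : Fin 4 → ℕ) (σ : Equiv.Perm (Fin 4)) :
    moment (shellPoints m) (d ∘ σ) = moment (shellPoints m) d := by
  refine Finset.sum_equiv (σ.symm.arrowCongr (Equiv.refl ℤ)).symm (fun x ↦ ?_) fun x _ ↦ ?_
  · simp only [mem_shellPoints, Equiv.arrowCongr_symm, Equiv.arrowCongr_apply, Equiv.symm_symm,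
      Equiv.refl_symm, Equiv.coe_refl, Function.comp_apply, id]
    rw [Equiv.sum_comp σ.symm (fun i ↦ x i ^ 2)]
  · simp only [Equiv.arrowCongr_symm, Equiv.arrowCongr_apply, Equiv.symm_symm,
      Equiv.refl_symm, Equiv.coe_refl, Function.comp_apply, id]
    rw [← Equiv.prod_comp σ (fun i ↦ ((x (σ.symm i) : ℤ) : ℝ) ^ d i)]
    simp

lemma moment_eq_zero_of_odd {m : ℕ} {d : Fin 4 → ℕ} {j : Fin 4} (hj : Odd (d j)) :
    moment (shellPoints m) d = 0 := by
  suffices moment (shellPoints m) d = -moment (shellPoints m) d by linarith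
  conv_rhs => rw [moment, ← Finset.sum_neg_distrib]
  have hsq : ∀ (x : Fin 4 → ℤ) i, (Function.update x j (-x j)) i ^ 2 = x i ^ 2 := by
    intro x i
    by_cases h : i = j
    · subst h; simp
    · simp [h]
  have hmem : ∀ x ∈ shellPoints m, Function.update x j (-x j) ∈ shellPoints m := by
    intro x hx
    rw [mem_shellPoints] at hx ⊢
    simpa only [hsq] using hx
  refine Finset.sum_nbij' (fun x ↦ Function.update x j (-x j)) (fun x ↦ Function.update x j (-x j))
    hmem hmem (by simp) (by simp) fun x _ ↦ ?_
  rw [← Finset.mul_prod_erase _ _ (Finset.mem_univ j),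
    ← Finset.mul_prod_erase (Finset.univ) (fun i ↦ ((Function.update x j (-x j) i : ℤ) : ℝ) ^ d i)
      (Finset.mem_univ j)]
  have h : ∏ i ∈ Finset.univ.erase j, ((Function.update x j (-x j) i : ℤ) : ℝ) ^ d i =
      ∏ i ∈ Finset.univ.erase j, (x i : ℝ) ^ d i := by
    refine Finset.prod_congr rfl fun i hi ↦ ?_
    rw [Function.update_of_ne (Finset.ne_of_mem_erase hi)]
  rw [h, Function.update_self, Int.cast_neg, hj.neg_pow]
  ring

lemma moment_swap01 {m : ℕ} (a b c d : ℕ) :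
    moment (shellPoints m) ![a, b, c, d] = moment (shellPoints m) ![b, a, c, d] := by
  rw [← moment_comp_perm _ (Equiv.swap 0 1)]
  congr 1
  ext i; fin_cases i <;> simp [Equiv.swap_apply_def]

lemma moment_swap12 {m : ℕ} (a b c d : ℕ) :
    moment (shellPoints m) ![a, b, c, d] = moment (shellPoints m) ![a, c, b, d] := by
  rw [← moment_comp_perm _ (Equiv.swap 1 2)]
  congr 1
  ext i; fin_cases i <;> simp [Equiv.swap_apply_def]

lemma moment_swap23 {m : ℕ} (a b c d : ℕ) :
    moment (shellPoints m) ![a, b, c, d] = moment (shellPoints m) ![a, b, d, c] := by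
  rw [← moment_comp_perm _ (Equiv.swap 2 3)]
  congr 1
  ext i; fin_cases i <;> simp [Equiv.swap_apply_def]

/-- Sign changes kill every monomial with an odd exponent, so the exponents are twice those of a
cubic monomial. -/
lemma sum_eval_eq_sum_moment {P : MvPolynomial (Fin 4) ℝ} (hP : P.IsHomogeneous 6) (m : ℕ) :
    ∑ x ∈ shellPoints m, eval (fun i ↦ (x i : ℝ)) P =
      ∑ e ∈ Finset.Nat.antidiagonalTuple 4 3,
        coeff (expVec (2 • e)) P * moment (shellPoints m) (2 • e) := by
  simp only [eval_eq_sum_antidiagonalTuple hP]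
  rw [Finset.sum_comm]
  simp only [← Finset.mul_sum]
  have hinj : Set.InjOn (fun e : Fin 4 → ℕ ↦ 2 • e) (Finset.Nat.antidiagonalTuple 4 3) := by
    intro a _ b _ hab
    ext i
    simpa using congrFun hab i
  rw [← Finset.sum_image (s := Finset.Nat.antidiagonalTuple 4 3) (g := fun e : Fin 4 → ℕ ↦ 2 • e)
    (f := fun d ↦ coeff (expVec d) P * moment (shellPoints m) d) hinj]
  symm
  refine Finset.sum_subset (fun d hd ↦ ?_) fun d hd hd' ↦ ?_
  · obtain ⟨e, he, rfl⟩ := Finset.mem_image.1 hd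
    rw [Finset.Nat.mem_antidiagonalTuple] at he ⊢
    simp only [Pi.smul_apply, smul_eq_mul, ← Finset.mul_sum, he, Nat.reduceMul]
  · by_cases h : ∃ j, Odd (d j)
    · obtain ⟨j, hj⟩ := h
      exact mul_eq_zero_of_right _ (moment_eq_zero_of_odd hj)
    · simp only [not_exists, Nat.not_odd_iff_even] at h
      refine absurd (Finset.mem_image.2 ⟨fun i ↦ d i / 2, ?_, ?_⟩) hd'
      · rw [Finset.Nat.mem_antidiagonalTuple] at hd ⊢
        have : ∑ i, 2 * (d i / 2) = 6 := by
          rw [← hd]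
          exact Finset.sum_congr rfl fun i _ ↦ Nat.two_mul_div_two_of_even (h i)
        rw [← Finset.mul_sum] at this
        omega
      · ext i
        simpa using Nat.two_mul_div_two_of_even (h i)

lemma coeff_laplacian (P : MvPolynomial (Fin 4) ℝ) (d : Fin 4 → ℕ) :
    coeff (expVec d) (laplacian 4 P) =
      ∑ j, (d j + 2) * (d j + 1) * coeff (expVec (d + Pi.single j 2)) P := by
  simp only [laplacian, LinearMap.sum_apply, LinearMap.comp_apply, coeff_sum]
  refine Finset.sum_congr rfl fun j _ ↦ ?_
  change coeff (expVec d) (pderiv j (pderiv j P)) = _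
  rw [coeff_pderiv, coeff_pderiv]
  have : expVec d + Finsupp.single j 1 + Finsupp.single j 1 = expVec (d + Pi.single j 2) := by
    ext i
    by_cases h : i = j
    · subst h; simp
    · simp [h]
  rw [this]
  simp
  ring

/-- The sum of the coefficients of the sixth powers of the variables. -/
noncomputable def pureCoeffSum (P : MvPolynomial (Fin 4) ℝ) : ℝ :=
  ∑ i, coeff (Finsupp.single i 6) P

lemma add_single_zero (a b c d k : ℕ) :
    (![a, b, c, d] + Pi.single 0 k : Fin 4 → ℕ) = ![a + k, b, c, d] := by
  ext i; fin_cases i <;> simp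

lemma add_single_one (a b c d k : ℕ) :
    (![a, b, c, d] + Pi.single 1 k : Fin 4 → ℕ) = ![a, b + k, c, d] := by
  ext i; fin_cases i <;> simp

lemma add_single_two (a b c d k : ℕ) :
    (![a, b, c, d] + Pi.single 2 k : Fin 4 → ℕ) = ![a, b, c + k, d] := by
  ext i; fin_cases i <;> simp

lemma add_single_three (a b c d k : ℕ) :
    (![a, b, c, d] + Pi.single 3 k : Fin 4 → ℕ) = ![a, b, c, d + k] := by
  ext i; fin_cases i <;> simp

lemma pureCoeffSum_eq (P : MvPolynomial (Fin 4) ℝ) : pureCoeffSum P =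
    coeff (expVec ![6, 0, 0, 0]) P + coeff (expVec ![0, 6, 0, 0]) P +
      coeff (expVec ![0, 0, 6, 0]) P + coeff (expVec ![0, 0, 0, 6]) P := by
  rw [pureCoeffSum, Fin.sum_univ_four]
  congr <;> (ext i; fin_cases i <;> simp)

lemma sum_sexticForm_eq_moment (m : ℕ) : ((∑ x ∈ shellPoints m, sexticForm x : ℤ) : ℝ) =
    moment (shellPoints m) ![6, 0, 0, 0] - 15 * moment (shellPoints m) ![4, 2, 0, 0] +
      30 * moment (shellPoints m) ![2, 2, 2, 0] := by
  simp only [moment, Finset.mul_sum, ← Finset.sum_sub_distrib, ← Finset.sum_add_distrib]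
  push_cast
  refine Finset.sum_congr rfl fun x _ ↦ ?_
  simp [sexticForm, Fin.prod_univ_four]

/-- For harmonic polynomials of degree `6`, sums over the shells of `D₄` are proportional to those
of a single form. -/
theorem sum_eval_of_mem_Harm {P : MvPolynomial (Fin 4) ℝ} (hP : P ∈ Harm 4 6) (m : ℕ) :
    ∑ x ∈ shellPoints m, eval (fun i ↦ (x i : ℝ)) P =
      pureCoeffSum P * ((∑ x ∈ shellPoints m, sexticForm x : ℤ) : ℝ) := by
  have hhom : P.IsHomogeneous 6 := (mem_homogeneousSubmodule _ _).1 hP.1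
  have hlap : laplacian 4 P = 0 := hP.2
  have H : ∀ a b c d : ℕ, ((a + 2) * (a + 1) * coeff (expVec ![a + 2, b, c, d]) P +
      (b + 2) * (b + 1) * coeff (expVec ![a, b + 2, c, d]) P +
      (c + 2) * (c + 1) * coeff (expVec ![a, b, c + 2, d]) P +
      (d + 2) * (d + 1) * coeff (expVec ![a, b, c, d + 2]) P : ℝ) = 0 := by
    intro a b c d
    have := coeff_laplacian P ![a, b, c, d]
    rw [hlap, Fin.sum_univ_four, add_single_zero, add_single_one, add_single_two,
      add_single_three] at this
    simpa using this.symm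
  have hlist : List.Nat.antidiagonalTuple 4 3 =
    [![0, 0, 0, 3], ![0, 0, 1, 2], ![0, 0, 2, 1], ![0, 0, 3, 0], ![0, 1, 0, 2], ![0, 1, 1, 1],
      ![0, 1, 2, 0], ![0, 2, 0, 1], ![0, 2, 1, 0], ![0, 3, 0, 0], ![1, 0, 0, 2], ![1, 0, 1, 1],
      ![1, 0, 2, 0], ![1, 1, 0, 1], ![1, 1, 1, 0], ![1, 2, 0, 0], ![2, 0, 0, 1], ![2, 0, 1, 0],
      ![2, 1, 0, 0], ![3, 0, 0, 0]] := by decide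
  rw [sum_eval_eq_sum_moment hhom, pureCoeffSum_eq, sum_sexticForm_eq_moment]
  -- The sum over the antidiagonal unfolds to a list, which makes its twenty terms explicit.
  change (List.map (fun e : Fin 4 → ℕ ↦ coeff (expVec (2 • e)) P *
    moment (shellPoints m) (2 • e)) (List.Nat.antidiagonalTuple 4 3)).sum = _
  rw [hlist]
  simp only [List.map_cons, List.map_nil, List.sum_cons, List.sum_nil, Matrix.smul_cons,
    smul_eq_mul, Matrix.smul_empty, Nat.reduceMul, mul_zero, add_zero]
  -- The coefficients of the Laplacian at x_i⁴ and at x_i²x_j² are the only relations needed.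
  have e1 := H 4 0 0 0
  have e2 := H 0 4 0 0
  have e3 := H 0 0 4 0
  have e4 := H 0 0 0 4
  have f1 := H 2 2 0 0
  have f2 := H 2 0 2 0
  have f3 := H 2 0 0 2
  have f4 := H 0 2 2 0
  have f5 := H 0 2 0 2
  have f6 := H 0 0 2 2
  norm_num at e1 e2 e3 e4 f1 f2 f3 f4 f5 f6
  -- By permutation symmetry only three moments remain, one for each exponent type (6), (4,2),
  -- (2,2,2).
  set A := moment (shellPoints m) ![6, 0, 0, 0] with hA
  set B := moment (shellPoints m) ![4, 2, 0, 0] with hB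
  set C := moment (shellPoints m) ![2, 2, 2, 0] with hC
  have a2 : moment (shellPoints m) ![0, 6, 0, 0] = A := moment_swap01 ..
  have a3 : moment (shellPoints m) ![0, 0, 6, 0] = A := (moment_swap12 ..).trans a2
  have a4 : moment (shellPoints m) ![0, 0, 0, 6] = A := (moment_swap23 ..).trans a3
  have b1 : moment (shellPoints m) ![2, 4, 0, 0] = B := moment_swap01 ..
  have b2 : moment (shellPoints m) ![4, 0, 2, 0] = B := moment_swap12 ..
  have b3 : moment (shellPoints m) ![2, 0, 4, 0] = B := (moment_swap12 ..).trans b1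
  have b4 : moment (shellPoints m) ![4, 0, 0, 2] = B := (moment_swap23 ..).trans b2
  have b5 : moment (shellPoints m) ![2, 0, 0, 4] = B := (moment_swap23 ..).trans b3
  have b6 : moment (shellPoints m) ![0, 4, 2, 0] = B := (moment_swap01 ..).trans b2
  have b7 : moment (shellPoints m) ![0, 2, 4, 0] = B := (moment_swap01 ..).trans b3
  have b8 : moment (shellPoints m) ![0, 4, 0, 2] = B := (moment_swap01 ..).trans b4
  have b9 : moment (shellPoints m) ![0, 2, 0, 4] = B := (moment_swap01 ..).trans b5
  have b10 : moment (shellPoints m) ![0, 0, 4, 2] = B := (moment_swap12 ..).trans b8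
  have b11 : moment (shellPoints m) ![0, 0, 2, 4] = B := (moment_swap12 ..).trans b9
  have c1 : moment (shellPoints m) ![2, 2, 0, 2] = C := moment_swap23 ..
  have c2 : moment (shellPoints m) ![2, 0, 2, 2] = C := (moment_swap12 ..).trans c1
  have c3 : moment (shellPoints m) ![0, 2, 2, 2] = C := (moment_swap01 ..).trans c2
  rw [a2, a3, a4, b1, b2, b3, b4, b5, b6, b7, b8, b9, b10, b11, c1, c2, c3]
  -- Let p, s, t be the coefficient sums of types (6), (4,2), (2,2,2). The relations add up to 30p +
  -- 2s = 0 and 12s + 6t = 0, so s = -15p and t = 30p, the coefficients of `sexticForm`.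
  linear_combination (B / 2 - C) * (e1 + e2 + e3 + e4) + C / 6 * (f1 + f2 + f3 + f4 + f5 + f6)

/-- The harmonic polynomial of degree `6` invariant under permutations and sign changes. -/
noncomputable def sexticHarmonic : MvPolynomial (Fin 4) ℝ :=
  16 * ∑ i, X i ^ 6 - 20 * ((∑ i, X i ^ 4) * ∑ i, X i ^ 2) + 5 * (∑ i, X i ^ 2) ^ 3

lemma isHomogeneous_sum_pow (k : ℕ) :
    (∑ i, X i ^ k : MvPolynomial (Fin 4) ℝ).IsHomogeneous k :=
  IsHomogeneous.sum _ _ _ fun i _ ↦ isHomogeneous_X_pow i k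

lemma IsHomogeneous.C_mul' {P : MvPolynomial (Fin 4) ℝ} {n : ℕ} (hP : P.IsHomogeneous n) (r : ℝ) :
    (C r * P).IsHomogeneous n := by
  simpa using (isHomogeneous_C (Fin 4) r).mul hP

lemma pderiv_sum_pow (k : ℕ) (j : Fin 4) :
    pderiv j (∑ i, X i ^ k : MvPolynomial (Fin 4) ℝ) = (k : MvPolynomial (Fin 4) ℝ) * X j ^ (k - 1) := by
  rw [map_sum, Finset.sum_eq_single j]
  · simp
  · intro i _ hi
    simp [Derivation.leibniz_pow, pderiv_X_of_ne hi]
  · simp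

lemma sexticHarmonic_mem_Harm : sexticHarmonic ∈ Harm 4 6 := by
  refine ⟨?_, ?_⟩
  · rw [SetLike.mem_coe, mem_homogeneousSubmodule]
    exact ((IsHomogeneous.C_mul' (isHomogeneous_sum_pow 6) 16).sub (IsHomogeneous.C_mul'
      ((isHomogeneous_sum_pow 4).mul (isHomogeneous_sum_pow 2)) 20)).add
      (IsHomogeneous.C_mul' ((isHomogeneous_sum_pow 2).pow 3) 5)
  · rw [SetLike.mem_coe, LinearMap.mem_ker, laplacian, LinearMap.sum_apply]
    change ∑ j, pderiv j (pderiv j sexticHarmonic) = 0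
    have hC (n : ℕ) [n.AtLeastTwo] (j : Fin 4) :
        pderiv j (OfNat.ofNat n : MvPolynomial (Fin 4) ℝ) = 0 := (pderiv j).map_natCast n
    have h1 (j : Fin 4) : pderiv j sexticHarmonic = 96 * X j ^ 5 - 20 * (4 * X j ^ 3 * ∑ i, X i ^ 2 +
        2 * (∑ i, X i ^ 4) * X j) + 30 * (∑ i, X i ^ 2) ^ 2 * X j := by
      simp only [sexticHarmonic, map_add, map_sub, Derivation.leibniz, Derivation.leibniz_pow,
        pderiv_sum_pow, hC, smul_eq_mul, nsmul_eq_mul]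
      push_cast
      ring
    have h2 (j : Fin 4) : pderiv j (pderiv j sexticHarmonic) = 160 * X j ^ 4 -
        120 * (∑ i, X i ^ 2) * X j ^ 2 - 40 * ∑ i, X i ^ 4 + 30 * (∑ i, X i ^ 2) ^ 2 := by
      rw [h1]
      simp only [map_add, map_sub, Derivation.leibniz, Derivation.leibniz_pow,
        pderiv_sum_pow, hC, pderiv_X_self, smul_eq_mul, nsmul_eq_mul]
      push_cast
      ring
    simp only [h2, Fin.sum_univ_four]
    ring

/-- It gives the pure coefficients of `sexticHarmonic` without expanding it: each is 16 - 20 + 5 =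
1. -/
lemma eval_single_eq_coeff {P : MvPolynomial (Fin 4) ℝ} {n : ℕ} (hP : P.IsHomogeneous n)
    (i : Fin 4) : eval (Pi.single i 1) P = coeff (Finsupp.single i n) P := by
  rw [eval_eq', Finset.sum_eq_single (Finsupp.single i n)]
  · rw [Finset.prod_eq_one, mul_one]
    intro j _
    by_cases h : j = i
    · subst h; simp
    · simp [Ne.symm h]
  · intro d hd hne
    have hdeg := hP (mem_support_iff.1 hd)
    rw [Finsupp.weight_apply, Finsupp.sum_fintype _ _ (by simp)] at hdeg
    obtain ⟨j, hj, hdj⟩ : ∃ j, j ≠ i ∧ d j ≠ 0 := by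
      by_contra! h
      apply hne
      have : d i = n := by
        rw [← hdeg, Finset.sum_eq_single i (fun j _ hj ↦ by simp [h j hj]) (by simp)]
        simp
      ext j
      by_cases hj : j = i
      · subst hj; simp [this]
      · rw [h j hj, Finsupp.single_apply, if_neg (Ne.symm hj)]
    rw [Finset.prod_eq_zero (Finset.mem_univ j), mul_zero]
    simp [hj, hdj]
  · intro h
    rw [notMem_support_iff.1 h, zero_mul]

lemma pureCoeffSum_sexticHarmonic : pureCoeffSum sexticHarmonic = 4 := by
  have hhom : sexticHarmonic.IsHomogeneous 6 :=
    (mem_homogeneousSubmodule _ _).1 sexticHarmonic_mem_Harm.1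
  simp only [pureCoeffSum, ← eval_single_eq_coeff hhom]
  simp only [sexticHarmonic]
  simp [Fin.sum_univ_four]
  norm_num

end LatticeDesign

end

/-! ### Shells of D₄ and the design criterion -/

section

open MvPolynomial

namespace LatticeDesign

/-- The point of Euclidean space with given integral coordinates. -/
noncomputable def latticePoint (x : Fin 4 → ℤ) : EuclideanSpace ℝ (Fin 4) :=
  WithLp.toLp 2 fun i ↦ (x i : ℝ)

@[simp] lemma latticePoint_apply (x : Fin 4 → ℤ) (i : Fin 4) : latticePoint x i = x i := rfl

lemma latticePoint_injective : Function.Injective latticePoint := by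
  intro x y h
  ext i
  have := congrArg (fun v : EuclideanSpace ℝ (Fin 4) ↦ v i) h
  simpa using this

lemma inner_latticePoint_self (x : Fin 4 → ℤ) :
    inner ℝ (latticePoint x) (latticePoint x) = ((∑ i, x i ^ 2 : ℤ) : ℝ) := by
  rw [PiLp.inner_apply]
  simp [sq]

lemma single_add_single_mem_D4 {i j : Fin 4} (hij : i ≠ j) {a b : ℝ} (ha : a = 1 ∨ a = -1)
    (hb : b = 1 ∨ b = -1) : EuclideanSpace.single i a + EuclideanSpace.single j b ∈ D4 :=
  AddSubgroup.subset_closure ⟨i, j, hij, a, b, ha, hb, rfl⟩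

/-- `D₄` consists of the integral points with even coordinate sum. -/
lemma mem_D4_iff {y : EuclideanSpace ℝ (Fin 4)} :
    y ∈ D4 ↔ ∃ x : Fin 4 → ℤ, Even (∑ i, x i) ∧ y = latticePoint x := by
  constructor
  · intro hy
    induction hy using AddSubgroup.closure_induction with
    | mem y hy =>
      obtain ⟨i, j, -, a, b, ha, hb, rfl⟩ := hy
      have h : ∀ c : ℝ, c = 1 ∨ c = -1 → ∃ n : ℤ, Odd n ∧ c = n := by
        rintro c (rfl | rfl)
        · exact ⟨1, by decide, by simp⟩
        · exact ⟨-1, by decide, by simp⟩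
      obtain ⟨n, hn, rfl⟩ := h a ha
      obtain ⟨k, hk, rfl⟩ := h b hb
      refine ⟨Pi.single i n + Pi.single j k, ?_, ?_⟩
      · simpa [Finset.sum_add_distrib] using hn.add_odd hk
      · ext l
        simp [Pi.single_apply]
    | zero => exact ⟨0, by simp, by ext; simp⟩
    | add y z _ _ hy hz =>
      obtain ⟨x, hx, rfl⟩ := hy
      obtain ⟨x', hx', rfl⟩ := hz
      exact ⟨x + x', by simpa [Finset.sum_add_distrib] using hx.add hx', by ext; simp⟩
    | neg y _ hy =>
      obtain ⟨x, hx, rfl⟩ := hy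
      exact ⟨-x, by simpa using hx, by ext; simp⟩
  · rintro ⟨x, ⟨k, hk⟩, rfl⟩
    rw [Fin.sum_univ_four] at hk
    have h1 : (1 : ℝ) = 1 ∨ (1 : ℝ) = -1 := Or.inl rfl
    have h2 : (-1 : ℝ) = 1 ∨ (-1 : ℝ) = -1 := Or.inr rfl
    -- Coordinates 0 and 1 are cleared by telescoping differences. The last two vectors fix
    -- coordinates 2 and 3, where the even sum 2k is used.
    have key : latticePoint x =
        x 0 • (EuclideanSpace.single 0 1 + EuclideanSpace.single 1 (-1)) +
        (x 0 + x 1) • (EuclideanSpace.single 1 1 + EuclideanSpace.single 2 (-1)) +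
        (k - x 3) • (EuclideanSpace.single 2 1 + EuclideanSpace.single 3 (-1)) +
        k • (EuclideanSpace.single 2 1 + EuclideanSpace.single 3 1) := by
      have h3 : (x 0 + x 1 + x 2 + x 3 : ℝ) = k + k := by exact_mod_cast hk
      ext i
      fin_cases i <;> simp
      linarith
    rw [key]
    refine add_mem (add_mem (add_mem ?_ ?_) ?_) ?_
    · exact zsmul_mem (single_add_single_mem_D4 (by decide) h1 h2) _
    · exact zsmul_mem (single_add_single_mem_D4 (by decide) h1 h2) _
    · exact zsmul_mem (single_add_single_mem_D4 (by decide) h1 h2) _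
    · exact zsmul_mem (single_add_single_mem_D4 (by decide) h1 h1) _

lemma shell_D4_eq (m : ℕ) : shell D4 (2 * m) = latticePoint '' (shellPoints m) := by
  ext y
  simp only [shell, Set.mem_ofPred_eq, mem_D4_iff, Set.mem_image, Finset.mem_coe, mem_shellPoints]
  constructor
  · rintro ⟨⟨x, -, rfl⟩, h⟩
    rw [inner_latticePoint_self] at h
    exact ⟨x, by exact_mod_cast h, rfl⟩
  · rintro ⟨x, hx, rfl⟩
    refine ⟨⟨x, ?_, rfl⟩, by rw [inner_latticePoint_self, hx]; push_cast; rfl⟩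
    -- Squaring preserves parity, so an even norm forces an even coordinate sum.
    have : Even (∑ i, x i ^ 2) := hx ▸ even_two_mul _
    rw [Fin.sum_univ_four] at this ⊢
    simpa [Int.even_add, Int.even_pow] using this

/-- Lagrange's four-square theorem; a design must be non-empty even when the sums vanish. -/
lemma shellPoints_nonempty (m : ℕ) : (shellPoints m).Nonempty := by
  obtain ⟨a, b, c, d, h⟩ := Nat.sum_four_squares (2 * m)
  refine ⟨![a, b, c, d], ?_⟩
  rw [mem_shellPoints, Fin.sum_univ_four]
  simpa using congrArg (Nat.cast : ℕ → ℤ) h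

variable {m : ℕ}

lemma normalizedShell_D4_eq (m : ℕ) : normalizedShell D4 (2 * m) =
    (fun x ↦ (1 / √((2 * m : ℕ) : ℝ)) • latticePoint x) '' (shellPoints m : Set (Fin 4 → ℤ)) := by
  rw [normalizedShell, shell_D4_eq, Set.image_image]

lemma one_div_sqrt_ne_zero (hm : 1 ≤ m) : 1 / √((2 * m : ℕ) : ℝ) ≠ 0 := by
  have : (0 : ℝ) < ((2 * m : ℕ) : ℝ) := by exact_mod_cast (by omega : 0 < 2 * m)
  positivity

lemma normalizedShell_D4_subset_sphere (hm : 1 ≤ m) :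
    normalizedShell D4 (2 * m) ⊆ Metric.sphere 0 1 := by
  have h0 : (0 : ℝ) < ((2 * m : ℕ) : ℝ) := by exact_mod_cast (by omega : 0 < 2 * m)
  rintro _ ⟨y, hy, rfl⟩
  have h : ‖y‖ = √((2 * m : ℕ) : ℝ) := by
    rw [← hy.2, real_inner_self_eq_norm_sq, Real.sqrt_sq (norm_nonneg _)]
  rw [mem_sphere_zero_iff_norm, norm_smul, h, Real.norm_of_nonneg (by positivity),
    one_div_mul_cancel (by positivity)]

lemma finsum_eval_normalizedShell_D4 (hm : 1 ≤ m) {ℓ : ℕ} {P : MvPolynomial (Fin 4) ℝ}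
    (hP : P.IsHomogeneous ℓ) :
    ∑ᶠ y ∈ normalizedShell D4 (2 * m), eval (fun i ↦ y i) P =
      (1 / √((2 * m : ℕ) : ℝ)) ^ ℓ * ∑ x ∈ shellPoints m, eval (fun i ↦ (x i : ℝ)) P := by
  have hinj : Function.Injective
      fun x ↦ (1 / √((2 * m : ℕ) : ℝ)) • latticePoint x :=
    (smul_right_injective _ (one_div_sqrt_ne_zero hm)).comp latticePoint_injective
  rw [normalizedShell_D4_eq, finsum_mem_image hinj.injOn, finsum_mem_coe_finset, Finset.mul_sum]
  refine Finset.sum_congr rfl fun x _ ↦ ?_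
  rw [eval_eq', eval_eq', Finset.mul_sum]
  refine Finset.sum_congr rfl fun d hd ↦ ?_
  have hdeg := hP (mem_support_iff.1 hd)
  rw [Finsupp.weight_apply, Finsupp.sum_fintype _ _ (by simp)] at hdeg
  simp only [Pi.one_apply, smul_eq_mul, mul_one] at hdeg
  simp only [PiLp.smul_apply, smul_eq_mul, latticePoint_apply, mul_pow, Finset.prod_mul_distrib,
    Finset.prod_pow_eq_pow_sum, hdeg]
  ring

theorem six_mem_harmonicStrength_iff (hm : 1 ≤ m) :
    6 ∈ harmonicStrength (normalizedShell D4 (2 * m)) ↔ tau2 m = 0 := by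
  rw [mem_harmonicStrength_iff, tau2_eq_zero_iff]
  have hsum : ∀ P ∈ Harm 4 6, ∑ᶠ y ∈ normalizedShell D4 (2 * m), eval (fun i ↦ y i) P =
      (1 / √((2 * m : ℕ) : ℝ)) ^ 6 *
        (pureCoeffSum P * ((∑ x ∈ shellPoints m, sexticForm x : ℤ) : ℝ)) := fun P hP ↦ by
    rw [finsum_eval_normalizedShell_D4 hm ((mem_homogeneousSubmodule _ _).1 hP.1),
      sum_eval_of_mem_Harm hP]
  constructor
  · intro h
    -- A single test polynomial suffices, because its factor `pureCoeffSum` is 4 and not 0.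
    have := h.sum_eq_zero 6 rfl _ sexticHarmonic_mem_Harm
    rw [hsum _ sexticHarmonic_mem_Harm, pureCoeffSum_sexticHarmonic] at this
    have h4 := (mul_eq_zero.1 this).resolve_left (pow_ne_zero 6 (one_div_sqrt_ne_zero hm))
    exact_mod_cast (mul_eq_zero.1 h4).resolve_left four_ne_zero
  · intro h
    refine ⟨?_, ?_, normalizedShell_D4_subset_sphere hm, ?_⟩
    · rw [normalizedShell_D4_eq]
      exact (shellPoints_nonempty m).to_set.image _
    · rw [normalizedShell_D4_eq]
      exact (shellPoints m).finite_toSet.image _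
    · rintro ℓ rfl P hP
      rw [hsum P hP, h, Int.cast_zero, mul_zero, mul_zero]

end LatticeDesign

end

theorem theorem8p1 :
    (∃ f : LatticeDesign.CuspFormGamma1 2 8,
      (∀ z : UpperHalfPlane, f z = LatticeDesign.etaProduct z) ∧
      LatticeDesign.IsNormalized f ∧
      ∀ g : LatticeDesign.CuspFormGamma1 2 8, LatticeDesign.IsNormalized g → g = f) ∧
    (∀ z : UpperHalfPlane,
      HasSum (fun m : ℕ ↦
          LatticeDesign.tau2 (m + 1) * Complex.exp (2 * Real.pi * Complex.I * z) ^ (m + 1))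
        (ModularForm.eta (z : ℂ) ^ 8 * ModularForm.eta (2 * (z : ℂ)) ^ 8)) ∧
    ∀ m : ℕ, 1 ≤ m →
      (6 ∈ LatticeDesign.harmonicStrength
          (LatticeDesign.normalizedShell LatticeDesign.D4 (2 * m)) ↔
        LatticeDesign.tau2 m = 0) :=
  ⟨⟨LatticeDesign.etaCuspForm, fun _ ↦ rfl, LatticeDesign.isNormalized_etaCuspForm,
      fun _ hg ↦ LatticeDesign.CuspFormGamma1.eq_of_isNormalized hg⟩,
    LatticeDesign.hasSum_tau2_succ, fun _ hm ↦ LatticeDesign.six_mem_harmonicStrength_iff hm⟩
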